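/- Let $\mathbb F_q$ be a finite field of characteristic different from $7$ containing an element $g$ of multiplicative order $z=6$, and let $\mathbb E=\{g^i\mid 1\le i\le 6\}$, $\mathbb E_0=\mathbb E\cup\{0\}$, $Q=\log_2 q$, $Z=\log_2 6$. Let $h(x)=-x\log_2x-(1-x)\log_2(1-x)$ and $\gamma(x,y)=-x\log_2x-y\log_2y-(1-x-y)\log_2(1-x-y)$, with $0\log_20=0$ (terms $0\cdot h(0/0)$ and $0\cdot \gamma(0/0,0/0)$ are read as $0$). Write $\binom{n}{k_1,k_2}=\binom{n}{k_1+k_2}\binom{k_1+k_2}{k_1}$. *Setting.* For each $n$ let $k,\ell,v_0,\varepsilon_1,\varepsilon_2,b_1,b_2$ be natural numbers (depending on $n$), put $v_i=v_{i-1}/2+\varepsilon_i+b_i$ for $i=1,2$, and assume that $k+\ell$, $v_0,v_1,v_2$ are even, $v_0\le k+\ell$, and $2b_{i+1}\le v_i$, $v_i+\varepsilon_{i+1}\le k+\ell$ for $i=0,1$. Assume that the limits $R=\lim k/n$, $L=\lim \ell/n$, $V_0=\lim v_0/n$, $E_i=\lim\varepsilon_i/n$, $B_i=\lim b_i/n$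 exist. A vector is well-formed on level $i$ if it lies in $\mathbb E_0^{k+\ell}$ and has Hamming weight $v_i$. A representation of a level-$i$ vector $e$ is a pair $(x,y)$ of well-formed level-$(i+1)$ vectors with $e=x+y$ such that $x,y$ are both nonzero on exactly $2b_{i+1}$ positions of the support of $e$ and cancel on exactly $\varepsilon_{i+1}$ positions outside it; $r_i$ denotes the number of representations and $u_i=\lfloor\log_q r_i\rfloor$ $(i=0,1)$. *Algorithm.* $\mathrm{BJMM}(2)_+$ with $\mathbb E_+=\mathbb E$, for a matrix $A\in\mathbb F_q^{(k+\ell)\times\ell}$ and $s\in\mathbb F_q^\ell$: enumerate the two base lists of vectors in $\mathbb E_0^{k+\ell}$ of weight $v_2/2$ supported on the first, respectively second, half of the positions; form four lists of level-2 vectors by concatenation merges of the base lists on the first $u_1$ syndrome positions with targets $s,0,0,0$; merge these pairwise to two lists of level-1 vectors on the first $u_0$ positions with targets $s,0$; merge these to a list of level-0 vectors on all $\ell$ positions with target $s$. Here merging two lists on $u$ positions with target $t$ means collecting, without repetition, the well-formed sums $x+y$ whose syndrome $(x+y)A$ agrees with $t$ on the first $u$ positions. It costs one step per element of each input list plus one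 step per colliding pair $(x,y)$. Enumerating a base list costs one step per element. The enumeration cost is the expected total number of steps for $A$ uniformly random. A positive sequence $a_n$ has exponent $c$ if $\frac1n\log_2a_n\to c$. *Claim.* Define, for $i=1,2$, for $i=0,1,2$, and for $i=0,1$ respectively, \begin{align*} V_i&=\tfrac{V_{i-1}}2+E_i+B_i,\\ \Sigma_i&=(R+L)\,h\!\left(\tfrac{V_i}{R+L}\right)+ZV_i,\\ U_i&=V_i\,\gamma\!\left(\tfrac{2B_{i+1}}{V_i},\tfrac{V_i/2-B_{i+1}}{V_i}\right)+2B_{i+1}+(R+L-V_i)\,h\!\left(\tfrac{E_{i+1}}{R+L-V_i}\right)+ZE_{i+1}, \end{align*} and suppose $U_1\le U_0\le QL$. Then: 1. $\mathbb E=\{\pm1,\pm g,\pm(g-1)\}$, and every $e\in\mathbb E$ has exactly two decompositions $e=e_1+e_2=e_2+e_1$ into ordered pairs of elements of $\mathbb E$, with $e_1\ne e_2$. 2. For $i=0,1,2$: $v_i/n\to V_i$, and the number of well-formed vectors on level $i$ has exponent $\Sigma_i$. 3. For $i=0,1$: every well-formed level-$i$ vector has exactly $\binom{v_i}{2b_{i+1},\,v_i/2-b_{i+1}}2^{2b_{i+1}}\binom{k+\ell-v_i}{\varepsilon_{i+1}}6^{\varepsilon_{i+1}}$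 representations; this number $r_i$ has exponent $U_i$, and $Q\,u_i/n\to U_i$. 4. For every choice of syndromes $s=s(n)\in\mathbb F_q^{\ell}$, the enumeration cost of $\mathrm{BJMM}(2)_+$ has exponent $$\max\left\{\tfrac{\Sigma_2}{2},\ \Sigma_2-U_1,\ 2\Sigma_2-U_1-U_0,\ 2\Sigma_1-U_0-QL\right\}.$$ -/

import Mathlib

open Filter Topology

namespace RSDP

universe u

/-- The binary entropy function, in bits. -/
noncomputable def h (x : ℝ) : ℝ :=
  -x * Real.logb 2 x - (1 - x) * Real.logb 2 (1 - x)

/-- The ternary entropy function, in bits, with arguments `x`, `y` and `1 - x - y`. -/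
noncomputable def tri (x y : ℝ) : ℝ :=
  -x * Real.logb 2 x - y * Real.logb 2 y - (1 - x - y) * Real.logb 2 (1 - x - y)

/-- The trinomial coefficient `n choose (k₁, k₂)`. -/
def trinomial (n k₁ k₂ : ℕ) : ℕ := n.choose (k₁ + k₂) * (k₁ + k₂).choose k₁

/-- The error set `{g ^ i | 1 ≤ i ≤ z}`, where `z` is the order of `g`. -/
noncomputable def errorSet {F : Type u} [Field F] [DecidableEq F] (g : F) : Finset F :=
  (Finset.Icc 1 (orderOf g)).image fun i => g ^ i

/-- The well-formed vectors of length `N` and weight `w`: entries in the error set or zero,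
and exactly `w` of them nonzero. -/
noncomputable def wellFormed {F : Type u} [Field F] [Fintype F] [DecidableEq F] (g : F) (N w : ℕ) :
    Finset (Fin N → F) :=
  Finset.univ.filter fun x => (∀ j, x j ∈ insert 0 (errorSet g)) ∧ hammingNorm x = w

/-- The representations `e = x + (e - x)` of `e` as a sum of two well-formed vectors of weight
`w`, given through the first summand `x`, in which both summands are nonzero on exactly `2 * b`
positions of the support of `e`, and cancel on exactly `ε` positions outside that support. -/
noncomputable def representations {F : Type u} [Field F] [Fintype F] [DecidableEq F] (g : F) {N : ℕ}
    (w ε b : ℕ) (e : Fin N → F) : Finset (Fin N → F) :=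
  Finset.univ.filter fun x =>
    x ∈ wellFormed g N w ∧ e - x ∈ wellFormed g N w ∧
    (Finset.univ.filter fun j => e j ≠ 0 ∧ x j ≠ 0 ∧ (e - x) j ≠ 0).card = 2 * b ∧
    (Finset.univ.filter fun j => e j = 0 ∧ x j ≠ 0).card = ε

/-- Parameters of the algorithm: the small instance has length `k + l`, syndromes of length `l`,
and solutions of weight `v₀`; `ε i` is the number of cancelling positions and `2 * b i` the number
of overlapping support positions between the two summands on level `i`, for `i = 1, 2`. -/
structure Params where
  k : ℕ
  l : ℕ
  v₀ : ℕ
  ε : ℕ → ℕ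
  b : ℕ → ℕ

/-- The length `k + l` of the small instance. -/
def Params.N (P : Params) : ℕ := P.k + P.l

/-- The weight `v_i` of the vectors on level `i`. -/
def Params.v (P : Params) : ℕ → ℕ
  | 0 => P.v₀
  | i + 1 => P.v i / 2 + P.ε (i + 1) + P.b (i + 1)

/-- The prescribed splittings are possible: all quantities that get halved are even, and there is
room for the prescribed numbers of positions. -/
structure Params.Admissible (P : Params) : Prop where
  even_length : Even P.N
  even_weight : ∀ i ≤ 2, Even (P.v i)
  weight_le : P.v₀ ≤ P.N
  overlap_le : ∀ i < 2, 2 * P.b (i + 1) ≤ P.v i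
  cancel_le : ∀ i < 2, P.v i + P.ε (i + 1) ≤ P.N

/-- The number `r_i` of representations of a level-`i` vector by two level-`(i + 1)` vectors
(it is the same for all well-formed vectors of weight `v_i`; formally a maximum is taken). -/
noncomputable def Params.r (P : Params) {F : Type u} [Field F] [Fintype F] [DecidableEq F] (g : F)
    (i : ℕ) : ℕ :=
  (wellFormed g P.N (P.v i)).sup fun e =>
    (representations g (P.v (i + 1)) (P.ε (i + 1)) (P.b (i + 1)) e).card

/-- The number of positions on which one merges, `u_i = log_q r_i`, rounded down. -/
noncomputable def Params.u (P : Params) {F : Type u} [Field F] [Fintype F] [DecidableEq F] (g : F)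
    (i : ℕ) : ℕ :=
  Nat.log (Fintype.card F) (P.r g i)

/-- A computation: its result together with the number of elementary list operations used. -/
structure Timed (α : Type u) where
  val : α
  steps : ℕ

instance : Monad Timed.{u} where
  pure a := ⟨a, 0⟩
  bind x f := ⟨(f x.val).val, x.steps + (f x.val).steps⟩

/-- Writing down a list, one step per entry. -/
def enumerate {α : Type u} (S : Finset α) : Timed (Finset α) := ⟨S, S.card⟩

/-- The syndrome `x A` agrees with the target `t` on the first `p` positions. -/
def Matches {F : Type u} [Field F] {N l : ℕ} (A : Matrix (Fin N) (Fin l) F) (p : ℕ)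
    (t : Fin l → F) (x : Fin N → F) : Prop :=
  ∀ j : Fin l, (j : ℕ) < p → (Matrix.vecMul x A) j = t j

/-- Merging `L₁` and `L₂` on the first `p` positions with target `t`, and filtering.
Every `x` in `L₁` is stored in a table, indexed by the first `p` entries of its syndrome (one
step). For every `y` in `L₂` the bucket of those `x` is looked up for which `x + y` matches the
target (one step), and each such sum is computed and kept if it lies in `W` (one step each).
The result is a list without repetitions. -/
noncomputable def merge {F : Type u} [Field F] [DecidableEq F] {N l : ℕ} (A : Matrix (Fin N) (Fin l) F) (p : ℕ)
    (t : Fin l → F) (W L₁ L₂ : Finset (Fin N → F)) : Timed (Finset (Fin N → F)) :=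
  open Classical in
  { val := W.filter fun w => ∃ x ∈ L₁, ∃ y ∈ L₂, Matches A p t (x + y) ∧ w = x + y
    steps := L₁.card + ∑ y ∈ L₂, (1 + (L₁.filter fun x => Matches A p t (x + y)).card) }

/-- The well-formed vectors of weight `w` supported on the first half of the positions. -/
noncomputable def baseLeft {F : Type u} [Field F] [Fintype F] [DecidableEq F] (g : F) (N w : ℕ) :
    Finset (Fin N → F) :=
  (wellFormed g N w).filter fun x => ∀ j : Fin N, x j ≠ 0 → (j : ℕ) < N / 2

/-- The well-formed vectors of weight `w` supported on the second half of the positions. -/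
noncomputable def baseRight {F : Type u} [Field F] [Fintype F] [DecidableEq F] (g : F) (N w : ℕ) :
    Finset (Fin N → F) :=
  (wellFormed g N w).filter fun x => ∀ j : Fin N, x j ≠ 0 → N / 2 ≤ (j : ℕ)

/-- The algorithm `BJMM(2)₊` with `E₊ = E`, searching for solutions `e` of weight `v₀` of
`e A = s`: four concatenation merges on `u₁` positions, then two representation merges on `u₀`
positions, then a final representation merge on all `l` positions. -/
noncomputable def bjmmPlus {F : Type u} [Field F] [Fintype F] [DecidableEq F] (g : F) (P : Params)
    (A : Matrix (Fin P.N) (Fin P.l) F) (s : Fin P.l → F) : Timed (Finset (Fin P.N → F)) := do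
  let B₁ ← enumerate (baseLeft g P.N (P.v 2 / 2))
  let B₂ ← enumerate (baseRight g P.N (P.v 2 / 2))
  let Y₁ ← merge A (P.u g 1) s (wellFormed g P.N (P.v 2)) B₁ B₂
  let Y₂ ← merge A (P.u g 1) 0 (wellFormed g P.N (P.v 2)) B₁ B₂
  let Y₃ ← merge A (P.u g 1) 0 (wellFormed g P.N (P.v 2)) B₁ B₂
  let Y₄ ← merge A (P.u g 1) 0 (wellFormed g P.N (P.v 2)) B₁ B₂
  let X₁ ← merge A (P.u g 0) s (wellFormed g P.N (P.v 1)) Y₁ Y₂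
  let X₂ ← merge A (P.u g 0) 0 (wellFormed g P.N (P.v 1)) Y₃ Y₄
  merge A P.l s (wellFormed g P.N (P.v 0)) X₁ X₂

/-- The enumeration cost: the expected number of steps over a uniformly random matrix `A`. -/
noncomputable def enumerationCost {F : Type u} [Field F] [Fintype F] [DecidableEq F] (g : F)
    (P : Params) (s : Fin P.l → F) : ℝ :=
  (∑ A : Matrix (Fin P.N) (Fin P.l) F, ((bjmmPlus g P A s).steps : ℝ)) /
    (Fintype.card (Matrix (Fin P.N) (Fin P.l) F) : ℝ)

/-- The sequence `a` has exponent `c`, that is, `a n = 2 ^ (c n + o(n))`. -/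
def HasExponent (a : ℕ → ℝ) (c : ℝ) : Prop :=
  (∀ᶠ n in atTop, 0 < a n) ∧ Tendsto (fun n : ℕ => Real.logb 2 (a n) / n) atTop (𝓝 c)

end RSDP

/-!
The element `g` is a root of `X² - X + 1`, and the error set is the group of sixth roots of unity.
If two of them add up to `1`, they are `g` and `1 - g`: the other candidates would force `7 = 0`
(`decomposition_one`). Scaling by an element of the group gives the additive structure of the error
set. Well-formed vectors and representations are then counted by choosing supports first
(`card_splittings`). Stirling's formula gives the exponent of a binomial coefficient in terms of
the continuous function `η x = -x log₂ x` (`hasExponent_choose`), which covers all degenerate limits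
uniformly, and the exponents of all sizes follow.

For the cost, write `q` for the size of the field and `p = max u₀ u₁`. The basic fact is that a
vector outside the span of `Z` has a uniformly distributed syndrome, independently of the syndromes
of the elements of `Z` (`expect_mul_ind`). A span of boundedly many vectors has boundedly many
elements, since the field is fixed. Hence the expected number of matching vectors in a list, given
the syndromes of few other vectors, is the naive one up to a constant number of exceptions
(`expect_mul_sum_ind_le`, `le_expect_mul_sum_ind`). Applied to the pairs `(x, x + y)`, this
determines the cost of the concatenation merges and of the first representation merges, and it
bounds the cost of the last merge from above. There, the dependent pairs are charged to the length
of the first list.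

The lower bound for the last merge has to show that merging without repetition finds all but a
subexponential factor of the level-1 vectors `w` with the required syndrome. Sufficiently many `w` have `2 ^ (n U₁ - o(n))`
representations whose summands have half of their weight on each half of the positions, so that
the concatenation merges can find them (`exists_balanced_splittings`), and each of these matches with
probability about `q ^ (-u₁)`, which is `2 ^ (-n U₁ + o(n))`. The second moment method
(`expect_both_match_ge`) yields, for a pair `(w, w')` that collides in the last merge, that both
vectors are found with probability `2 ^ (-o(n))`; the moments involved are bounded by adding the
representations one at a time.

Finally, the upper bound is a sum of products whose exponents are at most the claimed maximum, and
the lower bound is the one belonging to the term which attains the maximum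
(`hasExponent_enumerationCost`). The lower bounds that require long lists are only needed
if their terms exceed `Σ₂ / 2 ≥ 0`. In that case the exponents of the list lengths are positive;
in particular `Σ₁ > 0` forces `V₁ > 0` and thus `U₁ > 0`.
-/

namespace RSDP

universe w

/-! ### Calculus of exponents -/

namespace HasExponent

variable {a b : ℕ → ℝ} {c d : ℝ}

theorem congr (ha : HasExponent a c) (h : ∀ᶠ n in atTop, a n = b n) : HasExponent b c := by
  refine ⟨?_, ha.2.congr' ?_⟩
  · filter_upwards [ha.1, h] with n h1 h2
    rwa [← h2]
  · filter_upwards [h] with n h2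
    rw [h2]

theorem mul (ha : HasExponent a c) (hb : HasExponent b d) :
    HasExponent (fun n => a n * b n) (c + d) := by
  refine ⟨?_, (ha.2.add hb.2).congr' ?_⟩
  · filter_upwards [ha.1, hb.1] with n h1 h2 using mul_pos h1 h2
  · filter_upwards [ha.1, hb.1] with n h1 h2
    rw [Real.logb_mul h1.ne' h2.ne', add_div]

theorem inv (ha : HasExponent a c) : HasExponent (fun n => (a n)⁻¹) (-c) := by
  refine ⟨?_, ha.2.neg.congr' ?_⟩
  · filter_upwards [ha.1] with n h1 using inv_pos.2 h1
  · filter_upwards with n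
    rw [Real.logb_inv, neg_div]

theorem div (ha : HasExponent a c) (hb : HasExponent b d) :
    HasExponent (fun n => a n / b n) (c - d) := by
  simpa only [div_eq_mul_inv, sub_eq_add_neg] using ha.mul hb.inv

theorem const {K : ℝ} (hK : 0 < K) : HasExponent (fun _ => K) 0 :=
  ⟨Eventually.of_forall fun _ => hK, tendsto_const_div_atTop_nhds_zero_nat _⟩

theorem const_mul {K : ℝ} (hK : 0 < K) (ha : HasExponent a c) :
    HasExponent (fun n => K * a n) c := by
  simpa using (const hK).mul ha

theorem pow (ha : HasExponent a c) (k : ℕ) : HasExponent (fun n => a n ^ k) (k * c) := by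
  refine ⟨?_, (ha.2.const_mul (k : ℝ)).congr' ?_⟩
  · filter_upwards [ha.1] with n h1 using pow_pos h1 k
  · filter_upwards with n
    rw [Real.logb_pow, mul_div_assoc]

theorem le (ha : HasExponent a c) (hb : HasExponent b d) (h : ∀ᶠ n in atTop, a n ≤ b n) :
    c ≤ d := by
  refine le_of_tendsto_of_tendsto ha.2 hb.2 ?_
  filter_upwards [ha.1, h] with n h1 h2
  exact div_le_div_of_nonneg_right (Real.logb_le_logb_of_le one_lt_two h1 h2) n.cast_nonneg

theorem nonneg (ha : HasExponent a c) (h : ∀ᶠ n in atTop, 1 ≤ a n) : 0 ≤ c :=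
  (const one_pos).le ha h

theorem squeeze {f g : ℕ → ℝ} (hf : HasExponent f c) (hg : HasExponent g d) (hdc : d ≤ c)
    (h1 : ∀ᶠ n in atTop, f n ≤ a n) (h2 : ∀ᶠ n in atTop, a n ≤ g n) : HasExponent a c := by
  have hcd : c = d := le_antisymm
    (hf.le hg (by filter_upwards [h1, h2] with n h3 h4 using h3.trans h4)) hdc
  subst hcd
  refine ⟨?_, tendsto_of_tendsto_of_tendsto_of_le_of_le' hf.2 hg.2 ?_ ?_⟩
  · filter_upwards [hf.1, h1] with n h3 h4 using h3.trans_le h4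
  · filter_upwards [hf.1, h1] with n h3 h4
    exact div_le_div_of_nonneg_right (Real.logb_le_logb_of_le one_lt_two h3 h4) n.cast_nonneg
  · filter_upwards [hf.1, h1, h2] with n h3 h4 h5
    exact div_le_div_of_nonneg_right
      (Real.logb_le_logb_of_le one_lt_two (h3.trans_le h4) h5) n.cast_nonneg

/-- Bounds with possibly different exponents suffice if these are on the respective other side of
the target: comparing the bounds shows that all three agree. -/
theorem squeeze_le {f f' : ℕ → ℝ} {e : ℝ} (hf : HasExponent f c)
    (hf' : HasExponent f' d) (hec : e ≤ c) (hde : d ≤ e) (h1 : ∀ᶠ n in atTop, f n ≤ a n)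
    (h2 : ∀ᶠ n in atTop, a n ≤ f' n) : HasExponent a e := by
  have hcd := hf.le hf' (by filter_upwards [h1, h2] with n h3 h4 using h3.trans h4)
  obtain rfl : e = c := le_antisymm hec (hcd.trans hde)
  exact hf.squeeze hf' hde h1 h2

theorem sup (ha : HasExponent a c) (hb : HasExponent b d) :
    HasExponent (fun n => max (a n) (b n)) (max c d) := by
  refine ⟨?_, (ha.2.max hb.2).congr' ?_⟩
  · filter_upwards [ha.1] with n h1 using lt_max_of_lt_left h1
  · filter_upwards [ha.1, hb.1] with n h1 h2
    rcases le_total (a n) (b n) with h | h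
    · rw [max_eq_right h, max_eq_right]
      exact div_le_div_of_nonneg_right (Real.logb_le_logb_of_le one_lt_two h1 h) n.cast_nonneg
    · rw [max_eq_left h, max_eq_left]
      exact div_le_div_of_nonneg_right (Real.logb_le_logb_of_le one_lt_two h2 h) n.cast_nonneg

theorem add (ha : HasExponent a c) (hb : HasExponent b d) :
    HasExponent (fun n => a n + b n) (max c d) := by
  refine (ha.sup hb).squeeze ((ha.sup hb).const_mul two_pos) le_rfl ?_ ?_
  · filter_upwards [ha.1, hb.1] with n h1 h2
    exact max_le (by linarith) (by linarith)
  · filter_upwards with n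
    have := le_max_left (a n) (b n)
    have := le_max_right (a n) (b n)
    linarith

/-- A sequence with positive exponent tends to infinity. -/
theorem eventually_ge (ha : HasExponent a c) (hc : 0 < c) (K : ℝ) : ∀ᶠ n in atTop, K ≤ a n := by
  have hK : Tendsto (fun n : ℕ => Real.logb 2 (max K 1) / n) atTop (𝓝 0) :=
    tendsto_const_div_atTop_nhds_zero_nat _
  filter_upwards [ha.1, hK.eventually_lt ha.2 hc, eventually_gt_atTop 0] with n h1 h2 h3
  have h4 : Real.logb 2 (max K 1) < Real.logb 2 (a n) :=
    (div_lt_div_iff_of_pos_right (by exact_mod_cast h3)).1 h2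
  have h5 := (Real.logb_lt_logb_iff one_lt_two (by positivity) h1).1 h4
  exact (le_max_left _ _).trans h5.le

theorem sub_const (ha : HasExponent a c) (hc : 0 < c) {K : ℝ} (hK : 0 ≤ K) :
    HasExponent (fun n => a n - K) c := by
  refine (ha.const_mul (K := 1 / 2) (by norm_num)).squeeze ha le_rfl ?_ ?_
  · filter_upwards [ha.eventually_ge hc (2 * K)] with n h1
    linarith
  · filter_upwards with n
    linarith

/-- Powers of a fixed base have the limit of the scaled exponents as their exponent. -/
theorem const_pow {K : ℝ} (hK : 0 < K) {k : ℕ → ℕ} {κ : ℝ}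
    (hk : Tendsto (fun n => (k n : ℝ) / n) atTop (𝓝 κ)) :
    HasExponent (fun n => K ^ k n) (Real.logb 2 K * κ) := by
  refine ⟨Eventually.of_forall fun n => pow_pos hK _, (hk.const_mul (Real.logb 2 K)).congr' ?_⟩
  filter_upwards with n
  rw [Real.logb_pow]
  ring

end HasExponent

/-- The function `x ↦ - x log₂ x`. -/
noncomputable def eta (x : ℝ) : ℝ := Real.negMulLog x / Real.log 2

theorem continuous_eta : Continuous eta := Real.continuous_negMulLog.div_const _

theorem eta_eq (x : ℝ) : eta x = -x * Real.logb 2 x := by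
  rw [eta, Real.negMulLog, Real.logb, mul_div_assoc]

/-- The error term in Stirling's approximation of `log m!`. -/
noncomputable def stirlingError (m : ℕ) : ℝ := Real.log m.factorial - m * Real.log m + m

theorem stirlingError_nonneg (m : ℕ) : 0 ≤ stirlingError m := by
  rcases Nat.eq_zero_or_pos m with rfl | hm
  · simp [stirlingError]
  · have h1 := Stirling.le_log_factorial_stirling hm.ne'
    have h2 : 0 ≤ Real.log m := Real.log_natCast_nonneg m
    have h3 : 0 ≤ Real.log (2 * Real.pi) := Real.log_nonneg (by linarith [Real.pi_gt_three])
    unfold stirlingError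
    linarith

theorem stirlingError_le (m : ℕ) : stirlingError m ≤ 1 + Real.log (m + 1) := by
  rcases Nat.eq_zero_or_pos m with rfl | hm
  · simp [stirlingError]
  · obtain ⟨k, rfl⟩ : ∃ k, m = k + 1 := ⟨m - 1, by omega⟩
    have h1 : Stirling.stirlingSeq (k + 1) ≤ Stirling.stirlingSeq 1 :=
      Stirling.stirlingSeq'_antitone (Nat.zero_le k)
    have h2 := Real.log_le_log (Stirling.stirlingSeq'_pos k) h1
    rw [Stirling.log_stirlingSeq_formula, Stirling.stirlingSeq_one,
      Real.log_div (Real.exp_pos 1).ne' (by positivity), Real.log_exp,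
      Real.log_sqrt (by norm_num)] at h2
    have hpos : (0 : ℝ) < ((k + 1 : ℕ) : ℝ) := by positivity
    rw [Real.log_mul (by norm_num) hpos.ne', Real.log_div hpos.ne' (Real.exp_pos 1).ne',
      Real.log_exp] at h2
    have h3 : Real.log ((k + 1 : ℕ) : ℝ) ≤ Real.log (((k + 1 : ℕ) : ℝ) + 1) :=
      Real.log_le_log hpos (by linarith)
    have h4 : 0 ≤ Real.log ((k + 1 : ℕ) : ℝ) := Real.log_natCast_nonneg _
    unfold stirlingError
    linarith

theorem tendsto_stirlingError_div {m : ℕ → ℕ} {α : ℝ}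
    (hm : Tendsto (fun n => (m n : ℝ) / n) atTop (𝓝 α)) :
    Tendsto (fun n => stirlingError (m n) / n) atTop (𝓝 0) := by
  have hlog : Tendsto (fun n : ℕ => Real.log n / n) atTop (𝓝 0) :=
    (Real.isLittleO_log_id_atTop.tendsto_div_nhds_zero).comp tendsto_natCast_atTop_atTop
  have hc : Tendsto (fun n : ℕ => (1 + Real.log (|α| + 2)) / (n : ℝ)) atTop (𝓝 0) :=
    tendsto_const_div_atTop_nhds_zero_nat _
  have hsum := hc.add hlog
  rw [add_zero] at hsum
  refine tendsto_of_tendsto_of_tendsto_of_le_of_le' tendsto_const_nhds hsum ?_ ?_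
  · filter_upwards with n using div_nonneg (stirlingError_nonneg _) n.cast_nonneg
  · have hα : α < |α| + 1 := by linarith [le_abs_self α]
    filter_upwards [hm.eventually_lt_const hα, eventually_gt_atTop 0] with n h1 h2
    have hn : (1 : ℝ) ≤ n := by exact_mod_cast h2
    rw [← add_div]
    refine div_le_div_of_nonneg_right ((stirlingError_le _).trans ?_) n.cast_nonneg
    rw [div_lt_iff₀ (by linarith)] at h1
    rw [add_assoc, ← Real.log_mul (by positivity) (by positivity)]
    have : Real.log (m n + 1) ≤ Real.log ((|α| + 2) * n) :=
      Real.log_le_log (by positivity) (by nlinarith)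
    linarith

theorem log_choose_eq {a b : ℕ} (hab : b ≤ a) : Real.log (a.choose b) =
    stirlingError a - stirlingError b - stirlingError (a - b) +
      (a * Real.log a - b * Real.log b - (a - b : ℕ) * Real.log (a - b : ℕ)) := by
  have h := congrArg (fun k : ℕ => Real.log (k : ℝ)) (Nat.choose_mul_factorial_mul_factorial hab)
  have hc : ((a.choose b : ℕ) : ℝ) ≠ 0 := by exact_mod_cast (Nat.choose_pos hab).ne'
  have hf : ∀ k : ℕ, ((k.factorial : ℕ) : ℝ) ≠ 0 := fun k => by
    exact_mod_cast k.factorial_ne_zero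
  simp only [Nat.cast_mul] at h
  rw [Real.log_mul (mul_ne_zero hc (hf _)) (hf _), Real.log_mul hc (hf _)] at h
  have h2 : ((a - b : ℕ) : ℝ) = a - b := Nat.cast_sub hab
  unfold stirlingError
  rw [h2] at *
  linarith

/-- The terms `m log m` of Stirling's formula, scaled by `n`. The contributions `(m / n) log n` cancel
in the logarithm of a binomial coefficient. -/
theorem mul_log_div (m : ℕ) {n : ℕ} (hn : 0 < n) :
    (m * Real.log m) / n = -Real.negMulLog (m / n) + m / n * Real.log n := by
  have hn' : (n : ℝ) ≠ 0 := by exact_mod_cast hn.ne'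
  rcases Nat.eq_zero_or_pos m with rfl | hm
  · simp
  · have hm' : (m : ℝ) ≠ 0 := by exact_mod_cast hm.ne'
    rw [Real.negMulLog, Real.log_div hm' hn']
    ring

/-- The exponent of a binomial coefficient. The function `eta` is continuous at `0`, so that no
degenerate case has to be excluded. -/
theorem hasExponent_choose {a b : ℕ → ℕ} {α β : ℝ} (hab : ∀ n, b n ≤ a n)
    (ha : Tendsto (fun n => (a n : ℝ) / n) atTop (𝓝 α))
    (hb : Tendsto (fun n => (b n : ℝ) / n) atTop (𝓝 β)) :
    HasExponent (fun n => ((a n).choose (b n) : ℝ)) (eta β + eta (α - β) - eta α) := by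
  refine ⟨Eventually.of_forall fun n => Nat.cast_pos.2 (Nat.choose_pos (hab n)), ?_⟩
  have hd : Tendsto (fun n => ((a n - b n : ℕ) : ℝ) / n) atTop (𝓝 (α - β)) :=
    (ha.sub hb).congr fun n => by rw [Nat.cast_sub (hab n), sub_div]
  have herr := ((tendsto_stirlingError_div ha).sub (tendsto_stirlingError_div hb)).sub
    (tendsto_stirlingError_div hd)
  have heta := (((continuous_eta.tendsto β).comp hb).add ((continuous_eta.tendsto _).comp hd)).sub
    ((continuous_eta.tendsto α).comp ha)
  have := (herr.div_const (Real.log 2)).add heta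
  simp only [sub_zero, zero_div, zero_add] at this
  refine this.congr' ?_
  filter_upwards [eventually_gt_atTop 0] with n hn
  have h2 : Real.log 2 ≠ 0 := (Real.log_pos one_lt_two).ne'
  have hn' : (n : ℝ) ≠ 0 := by exact_mod_cast hn.ne'
  simp only [Function.comp, eta, Real.logb]
  rw [log_choose_eq (hab n)]
  have e1 := mul_log_div (a n) hn
  have e2 := mul_log_div (b n) hn
  have e3 := mul_log_div (a n - b n) hn
  have hs : ((a n - b n : ℕ) : ℝ) / n = a n / n - b n / n := by
    rw [Nat.cast_sub (hab n), sub_div]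
  have e4 : (a n * Real.log (a n) - b n * Real.log (b n)
      - (a n - b n : ℕ) * Real.log (a n - b n : ℕ)) / n =
      Real.negMulLog (b n / n) + Real.negMulLog ((a n - b n : ℕ) / n)
        - Real.negMulLog (a n / n) := by
    rw [sub_div, sub_div, e1, e2, e3, hs]
    ring
  rw [div_right_comm, add_div, e4]
  ring

theorem eta_zero : eta 0 = 0 := by simp [eta]

theorem eta_div {α β : ℝ} (hα : 0 < α) : α * eta (β / α) = eta β + β * Real.logb 2 α := by
  rcases eq_or_ne β 0 with rfl | hβ
  · simp [eta]
  · rw [eta_eq, eta_eq, Real.logb_div hβ hα.ne']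
    field_simp
    ring

/-- The entropy form of the exponent of a binomial coefficient. -/
theorem mul_h_div {α β : ℝ} (hβ : 0 ≤ β) (hβα : β ≤ α) :
    α * h (β / α) = eta β + eta (α - β) - eta α := by
  rcases (hβ.trans hβα).eq_or_lt with h0 | h0
  · obtain rfl : β = 0 := by linarith
    rw [← h0]; simp
    simp [eta]
  · have h1 : 1 - β / α = (α - β) / α := by field_simp
    have h2 : h (β / α) = eta (β / α) + eta ((α - β) / α) := by
      simp only [h, eta_eq, h1]
      ring
    rw [h2, mul_add, eta_div h0, eta_div h0, eta_eq α]
    ring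

/-- The entropy form of the exponent of a trinomial coefficient. -/
theorem mul_tri_div {α β δ : ℝ} (hβ : 0 ≤ β) (hδ : 0 ≤ δ) (h : β + δ ≤ α) :
    α * tri (β / α) (δ / α) = eta β + eta δ + eta (α - β - δ) - eta α := by
  rcases (show 0 ≤ α by linarith).eq_or_lt with h0 | h0
  · obtain rfl : β = 0 := by linarith
    obtain rfl : δ = 0 := by linarith
    rw [← h0]; simp
    simp [eta]
  · have h1 : 1 - β / α - δ / α = (α - β - δ) / α := by field_simp
    have h2 : tri (β / α) (δ / α) = eta (β / α) + eta (δ / α) + eta ((α - β - δ) / α) := by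
      simp only [tri, eta_eq, h1]
      ring
    rw [h2, mul_add, mul_add, eta_div h0, eta_div h0, eta_div h0, eta_eq α]
    ring

/-! ### The error set -/

section ErrorSet

variable {F : Type w} [Field F] {g : F}

theorem two_ne_zero_of_orderOf (hg : orderOf g = 6) : (2 : F) ≠ 0 := by
  intro h
  have h6 : g ^ 6 = 1 := hg ▸ pow_orderOf_eq_one g
  have h3 : g ^ 3 ≠ 1 := pow_ne_one_of_lt_orderOf (by norm_num) (by omega)
  apply h3
  have : (g ^ 3 - 1) ^ 2 = 0 := by linear_combination h6 + (1 - g ^ 3) * h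
  exact sub_eq_zero.1 (pow_eq_zero_iff (by norm_num) |>.1 this)

theorem three_ne_zero_of_orderOf (hg : orderOf g = 6) : (3 : F) ≠ 0 := by
  intro h
  have h6 : g ^ 6 = 1 := hg ▸ pow_orderOf_eq_one g
  have h2 : g ^ 2 ≠ 1 := pow_ne_one_of_lt_orderOf (by norm_num) (by omega)
  apply h2
  have : (g ^ 2 - 1) ^ 3 = 0 := by linear_combination h6 + (g ^ 2 - g ^ 4) * h
  exact sub_eq_zero.1 (pow_eq_zero_iff (by norm_num) |>.1 this)

/-- An element of order six is a root of the sixth cyclotomic polynomial. -/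
theorem sq_eq_of_orderOf (hg : orderOf g = 6) : g ^ 2 = g - 1 := by
  have h6 : g ^ 6 = 1 := hg ▸ pow_orderOf_eq_one g
  have h3 : g ^ 3 ≠ 1 := pow_ne_one_of_lt_orderOf (by norm_num) (by omega)
  have h2 : g ^ 2 ≠ 1 := pow_ne_one_of_lt_orderOf (by norm_num) (by omega)
  have h4 : (g ^ 3 - 1) * ((g + 1) * (g ^ 2 - g + 1)) = 0 := by linear_combination h6
  rcases mul_eq_zero.1 h4 with h | h
  · exact absurd (sub_eq_zero.1 h) h3
  rcases mul_eq_zero.1 h with h | h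
  · exact absurd (by linear_combination (g - 1) * h) h2
  · linear_combination h

variable [DecidableEq F]

theorem errorSet_eq (hg : orderOf g = 6) : errorSet g = {1, -1, g, -g, g - 1, -(g - 1)} := by
  have h2 := sq_eq_of_orderOf hg
  have h3 : g ^ 3 = -1 := by linear_combination (g + 1) * h2
  have h4 : g ^ 4 = -g := by linear_combination g * h3
  have h5 : g ^ 5 = -(g - 1) := by linear_combination g ^ 2 * h3 - h2
  have h6 : g ^ 6 = 1 := hg ▸ pow_orderOf_eq_one g
  have hI : Finset.Icc 1 6 = ({1, 2, 3, 4, 5, 6} : Finset ℕ) := by decide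
  rw [errorSet, hg, hI]
  simp only [Finset.image_insert, Finset.image_singleton, pow_one, h2, h3, h4, h5, h6]
  ext x
  simp only [Finset.mem_insert, Finset.mem_singleton]
  tauto

/-- The error set consists of the sixth roots of unity. -/
theorem mem_errorSet (hg : orderOf g = 6) {x : F} : x ∈ errorSet g ↔ x ^ 6 = 1 := by
  have h2 := sq_eq_of_orderOf hg
  constructor
  · intro hx
    obtain ⟨i, -, rfl⟩ := Finset.mem_image.1 hx
    rw [← pow_mul, mul_comm, pow_mul, ← hg, pow_orderOf_eq_one, one_pow]
  · intro hx
    have : (x - 1) * ((x + 1) * ((x - g) * ((x + (g - 1)) *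
        ((x + g) * (x - (g - 1)))))) = 0 := by
      have e1 : (x - g) * (x + (g - 1)) = x ^ 2 - x + 1 := by linear_combination -h2
      have e2 : (x + g) * (x - (g - 1)) = x ^ 2 + x + 1 := by linear_combination -h2
      linear_combination (x - 1) * (x + 1) * ((x + g) * (x - (g - 1))) * e1
        + (x - 1) * (x + 1) * (x ^ 2 - x + 1) * e2 + hx
    rw [errorSet_eq hg]
    simp only [mul_eq_zero, sub_eq_zero, add_eq_zero_iff_eq_neg] at this
    simp only [Finset.mem_insert, Finset.mem_singleton]
    tauto

theorem zero_notMem_errorSet (hg : orderOf g = 6) : (0 : F) ∉ errorSet g := by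
  simp [mem_errorSet hg]

theorem neg_mem_errorSet (hg : orderOf g = 6) {x : F} : -x ∈ errorSet g ↔ x ∈ errorSet g := by
  rw [mem_errorSet hg, mem_errorSet hg, Even.neg_pow (by decide)]

theorem card_errorSet (hg : orderOf g = 6) : (errorSet g).card = 6 := by
  rw [errorSet, hg, Finset.card_image_of_injOn, Nat.card_Icc]
  intro i hi j hj hij
  simp only [Finset.coe_Icc, Set.mem_Icc] at hi hj
  have h0 : g ≠ 0 := by
    rintro rfl
    simp at hg
  have key : ∀ i j : ℕ, 1 ≤ i → j ≤ 6 → i < j → g ^ i ≠ g ^ j := by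
    intro i j hi hj hlt h
    have h1 : g ^ (j - i) ≠ 1 := pow_ne_one_of_lt_orderOf (by omega) (by omega)
    apply h1
    have h2 : g ^ i * g ^ (j - i) = g ^ i * 1 := by rw [← pow_add, mul_one, h]; congr 1; omega
    exact mul_left_cancel₀ (pow_ne_zero _ h0) h2
  rcases lt_trichotomy i j with h | h | h
  · exact absurd hij (key i j hi.1 hj.2 h)
  · exact h
  · exact absurd hij.symm (key j i hj.1 hi.2 h)

/-- The only ways to write `1` as a sum of two sixth roots of unity are `g + (1 - g)` and
`(1 - g) + g`. The excluded candidates would give `2 ^ 6 = 1` or `3 ^ 3 = -1`, which happens in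
characteristics `2`, `3` and `7` only. -/
theorem decomposition_one (hg : orderOf g = 6) (h7 : (7 : F) ≠ 0) {x : F} (hx : x ∈ errorSet g)
    (hx' : 1 - x ∈ errorSet g) : x = g ∨ x = 1 - g := by
  have h2 := sq_eq_of_orderOf hg
  have n2 := two_ne_zero_of_orderOf hg
  have n3 := three_ne_zero_of_orderOf hg
  have h28 : (28 : F) ≠ 0 := by
    have : (28 : F) = 2 * 2 * 7 := by norm_num
    rw [this]
    exact mul_ne_zero (mul_ne_zero n2 n2) h7
  have h63 : (63 : F) ≠ 0 := by
    have : (63 : F) = 3 * 3 * 7 := by norm_num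
    rw [this]
    exact mul_ne_zero (mul_ne_zero n3 n3) h7
  rw [mem_errorSet hg] at hx'
  rw [errorSet_eq hg] at hx
  simp only [Finset.mem_insert, Finset.mem_singleton] at hx
  rcases hx with rfl | rfl | rfl | rfl | rfl | rfl
  · norm_num at hx'
  · exact absurd (by linear_combination hx') h63
  · exact Or.inl rfl
  · have e : (1 - -g) ^ 2 = 3 * g := by linear_combination h2
    have e3 : g ^ 3 = -1 := by linear_combination (g + 1) * h2
    refine absurd ?_ h28
    linear_combination -hx' + ((1 - -g) ^ 4 + (1 - -g) ^ 2 * (3 * g) + (3 * g) ^ 2) * e + 27 * e3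
  · have e : (1 - (g - 1)) ^ 2 = 3 * (1 - g) := by linear_combination h2
    have e3 : (1 - g) ^ 3 = -1 := by linear_combination (2 - g) * h2
    refine absurd ?_ h28
    linear_combination -hx' + ((1 - (g - 1)) ^ 4 + (1 - (g - 1)) ^ 2 * (3 * (1 - g))
      + (3 * (1 - g)) ^ 2) * e + 27 * e3
  · exact Or.inr (by ring)

theorem decomposition_iff (hg : orderOf g = 6) (h7 : (7 : F) ≠ 0) {e x : F} (he : e ∈ errorSet g) :
    (x ∈ errorSet g ∧ e - x ∈ errorSet g) ↔ x = e * g ∨ x = e * (1 - g) := by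
  have he6 := (mem_errorSet hg).1 he
  have h2 := sq_eq_of_orderOf hg
  have e3 : g ^ 3 = -1 := by linear_combination (g + 1) * h2
  have e3' : (1 - g) ^ 3 = -1 := by linear_combination (2 - g) * h2
  have g6 : g ^ 6 = 1 := by linear_combination (g ^ 3 - 1) * e3
  have g6' : (1 - g) ^ 6 = 1 := by linear_combination ((1 - g) ^ 3 - 1) * e3'
  have h0 : e ≠ 0 := fun h => zero_notMem_errorSet hg (h ▸ he)
  constructor
  · rintro ⟨h1, h3⟩
    have h4 : x / e ∈ errorSet g := by
      rw [mem_errorSet hg] at *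
      rw [div_pow, h1, he6, div_one]
    have h5 : 1 - x / e ∈ errorSet g := by
      have : 1 - x / e = (e - x) / e := by field_simp
      rw [this]
      rw [mem_errorSet hg] at *
      rw [div_pow, h3, he6, div_one]
    rcases decomposition_one hg h7 h4 h5 with h | h
    · left; rw [← h]; field_simp
    · right; rw [← h]; field_simp
  · rintro (rfl | rfl)
    · rw [mem_errorSet hg, mem_errorSet hg, show e - e * g = e * (1 - g) by ring, mul_pow, mul_pow,
        he6, g6, g6']
      simp
    · rw [mem_errorSet hg, mem_errorSet hg, show e - e * (1 - g) = e * g by ring, mul_pow, mul_pow,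
        he6, g6, g6']
      simp

theorem decomposition_ne (hg : orderOf g = 6) {e : F} (he : e ∈ errorSet g) :
    e * g ≠ e * (1 - g) := by
  have h0 : e ≠ 0 := fun h => zero_notMem_errorSet hg (h ▸ he)
  have h2 := sq_eq_of_orderOf hg
  intro h
  have h1 := mul_left_cancel₀ h0 h
  refine three_ne_zero_of_orderOf hg ?_
  linear_combination 4 * h2 - (2 * g - 1) * h1

theorem card_decompositions (hg : orderOf g = 6) (h7 : (7 : F) ≠ 0) {e : F}
    (he : e ∈ errorSet g) : ((errorSet g).filter fun x => e - x ∈ errorSet g).card = 2 := by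
  have : ((errorSet g).filter fun x => e - x ∈ errorSet g) = {e * g, e * (1 - g)} := by
    ext x
    rw [Finset.mem_filter, decomposition_iff hg h7 he]
    simp
  rw [this, Finset.card_pair (decomposition_ne hg he)]

theorem exists_decompositions (hg : orderOf g = 6) (h7 : (7 : F) ≠ 0) (e : F)
    (he : e ∈ errorSet g) : ∃ e₁ ∈ errorSet g, ∃ e₂ ∈ errorSet g, e₁ ≠ e₂ ∧
      (errorSet g ×ˢ errorSet g).filter (fun p => p.1 + p.2 = e) = {(e₁, e₂), (e₂, e₁)} := by
  have h1 := (decomposition_iff hg h7 he).2 (Or.inl rfl)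
  have h2 := (decomposition_iff hg h7 he).2 (Or.inr rfl)
  refine ⟨e * g, h1.1, e * (1 - g), h2.1, decomposition_ne hg he, ?_⟩
  ext ⟨a, b⟩
  simp only [Finset.mem_filter, Finset.mem_product, Finset.mem_insert, Finset.mem_singleton,
    Prod.mk.injEq]
  constructor
  · rintro ⟨⟨ha, hb⟩, hab⟩
    have hb' : b = e - a := by linear_combination hab
    subst hb'
    rcases (decomposition_iff hg h7 he).1 ⟨ha, hb⟩ with h | h
    · left; exact ⟨h, by rw [h]; ring⟩
    · right; exact ⟨h, by rw [h]; ring⟩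
  · rintro (⟨rfl, rfl⟩ | ⟨rfl, rfl⟩)
    · exact ⟨⟨h1.1, h2.1⟩, by ring⟩
    · exact ⟨⟨h2.1, h1.1⟩, by ring⟩

end ErrorSet

/-! ### Counting vectors by their supports -/

section Counting

variable {F : Type w} [Field F] [DecidableEq F]
variable {ι : Type*} [Fintype ι] [DecidableEq ι] {g : F}

/-- The possible values at position `j` of the first summand of a decomposition of `e`, if `x` is
nonzero on `D` within the support of `e` and on `C` outside, and the overlap is `O`. -/
noncomputable def splitChoices (g : F) (e : ι → F) (D O C : Finset ι) (j : ι) : Finset F :=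
  if j ∈ O then (errorSet g).filter fun x => e j - x ∈ errorSet g
  else if j ∈ D then {e j}
  else if j ∈ C then errorSet g
  else {0}

/-- Membership in the sets of possible values expresses, position by position, that `x` is the first
summand of a decomposition of `e` with the given supports. -/
theorem mem_splitChoices (hg : orderOf g = 6) {e : ι → F} (he : ∀ j, e j ∈ insert 0 (errorSet g))
    {D O C : Finset ι} (hO : O ⊆ D) (hD : D ⊆ Finset.univ.filter fun j => e j ≠ 0)
    (hC : C ⊆ (Finset.univ.filter fun j => e j ≠ 0)ᶜ) (x : ι → F) (j : ι) :
    x j ∈ splitChoices g e D O C j ↔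
      x j ∈ insert 0 (errorSet g) ∧ (e - x) j ∈ insert 0 (errorSet g) ∧
      (j ∈ D ↔ e j ≠ 0 ∧ x j ≠ 0) ∧ (j ∈ O ↔ e j ≠ 0 ∧ x j ≠ 0 ∧ (e - x) j ≠ 0) ∧
      (j ∈ C ↔ e j = 0 ∧ x j ≠ 0) := by
  have h0 := zero_notMem_errorSet hg
  have hne : ∀ {y : F}, y ∈ errorSet g → y ≠ 0 := fun hy h => h0 (h ▸ hy)
  have hej := he j
  have hOD := @hO j
  have hDs := @hD j
  have hCs := @hC j
  simp only [Finset.mem_filter, Finset.mem_univ, true_and, Finset.mem_compl, not_not] at hDs hCs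
  simp only [Pi.sub_apply, Finset.mem_insert] at hej ⊢
  unfold splitChoices
  split_ifs with h1 h2 h3
  · have hD' := hOD h1
    have he0 := hDs hD'
    have hC' : j ∉ C := fun h => he0 (hCs h)
    simp only [Finset.mem_filter, h1, hD', hC', he0, true_iff, ne_eq, not_false_eq_true,
      true_and, false_and, not_false_eq_true, and_true]
    constructor
    · rintro ⟨h4, h5⟩
      exact ⟨Or.inr h4, Or.inr h5, hne h4, hne h4, hne h5⟩
    · rintro ⟨h4, h5, h6, -, h7⟩
      exact ⟨h4.resolve_left h6, h5.resolve_left h7⟩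
  · have he0 := hDs h2
    have hC' : j ∉ C := fun h => he0 (hCs h)
    have heE := hej.resolve_left he0
    simp only [Finset.mem_singleton, h1, h2, hC', he0, true_iff, false_iff, ne_eq,
      not_false_eq_true, true_and, false_and, and_true, not_and, not_not]
    constructor
    · intro h4
      rw [h4]
      exact ⟨Or.inr heE, Or.inl (sub_self _), he0, fun _ => sub_self _⟩
    · rintro ⟨-, -, h6, h7⟩
      exact (sub_eq_zero.1 (h7 h6)).symm
  · have he0 := hCs h3
    simp only [h1, h2, h3, he0, true_iff, ne_eq, not_true_eq_false,
      true_and, false_and, zero_sub, neg_eq_zero, neg_mem_errorSet hg]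
    constructor
    · intro h4
      exact ⟨Or.inr h4, Or.inr h4, hne h4⟩
    · rintro ⟨h4, -, h6⟩
      exact h4.resolve_left h6
  · simp only [Finset.mem_singleton, h1, h2, h3, false_iff, ne_eq, not_and, not_not]
    constructor
    · intro h4
      rw [h4, sub_zero]
      exact ⟨Or.inl rfl, hej, fun _ => rfl, fun _ h => absurd rfl h, fun _ => rfl⟩
    · rintro ⟨-, -, h6, -, h8⟩
      by_cases h9 : e j = 0
      · exact h8 h9
      · exact h6 h9

theorem card_splitChoices_pi (hg : orderOf g = 6) (h7 : (7 : F) ≠ 0) {e : ι → F}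
    (he : ∀ j, e j ∈ insert 0 (errorSet g))
    {D O C : Finset ι} (hO : O ⊆ D) (hD : D ⊆ Finset.univ.filter fun j => e j ≠ 0)
    (hC : C ⊆ (Finset.univ.filter fun j => e j ≠ 0)ᶜ) :
    (Fintype.piFinset (splitChoices g e D O C)).card = 2 ^ O.card * 6 ^ C.card := by
  rw [Fintype.card_piFinset]
  have : ∀ j, (splitChoices g e D O C j).card =
      (if j ∈ O then 2 else 1) * (if j ∈ C then 6 else 1) := by
    intro j
    have hOD := @hO j
    have hDs := @hD j
    have hCs := @hC j
    have hej := he j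
    simp only [Finset.mem_filter, Finset.mem_univ, true_and, Finset.mem_compl, not_not] at hDs hCs
    rw [Finset.mem_insert] at hej
    unfold splitChoices
    by_cases h1 : j ∈ O
    · have he0 := hDs (hOD h1)
      have hC' : j ∉ C := fun h => he0 (hCs h)
      simp only [h1, hC', if_true, if_false]
      rw [card_decompositions hg h7 (hej.resolve_left he0)]
    · by_cases h2 : j ∈ D
      · have hC' : j ∉ C := fun h => hDs h2 (hCs h)
        simp [h1, h2, hC']
      · by_cases h3 : j ∈ C
        · simp [h1, h2, h3, card_errorSet hg]
        · simp [h1, h2, h3]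
  simp only [this]
  rw [Finset.prod_mul_distrib, Finset.prod_ite_mem, Finset.prod_ite_mem]
  simp

variable [Fintype F]

/-- The well-formed vectors of weight `w` on an arbitrary finite set of positions. -/
noncomputable def wellFormedOn (g : F) (ι : Type*) [Fintype ι] [DecidableEq ι] (w : ℕ) :
    Finset (ι → F) :=
  Finset.univ.filter fun x => (∀ j, x j ∈ insert 0 (errorSet g)) ∧ hammingNorm x = w

/-- The first summands `x` of the decompositions `e = x + (e - x)` into vectors over the error set
and zero, where `a` is the number of positions in the support of `e` at which only `x` is nonzero,
`o` is the number of those at which `x` and `e - x` are both nonzero, and `c` is the number of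
cancelling positions. -/
noncomputable def splittings (g : F) (e : ι → F) (a o c : ℕ) : Finset (ι → F) :=
  Finset.univ.filter fun x =>
    (∀ j, x j ∈ insert 0 (errorSet g)) ∧ (∀ j, (e - x) j ∈ insert 0 (errorSet g)) ∧
    (Finset.univ.filter fun j => e j ≠ 0 ∧ x j ≠ 0).card = a + o ∧
    (Finset.univ.filter fun j => e j ≠ 0 ∧ x j ≠ 0 ∧ (e - x) j ≠ 0).card = o ∧
    (Finset.univ.filter fun j => e j = 0 ∧ x j ≠ 0).card = c

/-- The splittings are counted by grouping them according to the supports `D`, `O` and `C`. -/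
theorem card_splittings (hg : orderOf g = 6) (h7 : (7 : F) ≠ 0) {e : ι → F}
    (he : ∀ j, e j ∈ insert 0 (errorSet g)) (a o c : ℕ) :
    (splittings g e a o c).card =
      (hammingNorm e).choose (a + o) * (a + o).choose o * 2 ^ o *
        ((Fintype.card ι - hammingNorm e).choose c * 6 ^ c) := by
  set supp := Finset.univ.filter fun j => e j ≠ 0 with hsupp
  have hv : supp.card = hammingNorm e := rfl
  let T : Finset ((_ : Finset ι) × Finset ι) :=
    (supp.powersetCard (a + o)).sigma fun D => D.powersetCard o
  let f : (ι → F) → ((_ : Finset ι) × Finset ι) × Finset ι := fun x =>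
    (⟨Finset.univ.filter fun j => e j ≠ 0 ∧ x j ≠ 0,
      Finset.univ.filter fun j => e j ≠ 0 ∧ x j ≠ 0 ∧ (e - x) j ≠ 0⟩,
      Finset.univ.filter fun j => e j = 0 ∧ x j ≠ 0)
  have hf : ∀ x ∈ splittings g e a o c, f x ∈ T ×ˢ Finset.powersetCard c suppᶜ := by
    intro x hx
    obtain ⟨-, -, h1, h2, h3⟩ := (Finset.mem_filter.1 hx).2
    refine Finset.mem_product.2 ⟨Finset.mem_sigma.2 ⟨?_, ?_⟩, ?_⟩ <;> rw [Finset.mem_powersetCard]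
    · exact ⟨fun j hj => by simp [hsupp, f] at hj ⊢; exact hj.1, h1⟩
    · exact ⟨fun j hj => by simp [f] at hj ⊢; exact ⟨hj.1, hj.2.1⟩, h2⟩
    · exact ⟨fun j hj => by simp [hsupp, f] at hj ⊢; exact hj.1, h3⟩
  rw [Finset.card_eq_sum_card_fiberwise hf]
  have hfib : ∀ t ∈ T ×ˢ Finset.powersetCard c suppᶜ,
      ((splittings g e a o c).filter fun x => f x = t).card = 2 ^ o * 6 ^ c := by
    rintro ⟨⟨D, O⟩, C⟩ ht
    obtain ⟨ht1, ht2⟩ := Finset.mem_product.1 ht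
    obtain ⟨hD, hO⟩ := Finset.mem_sigma.1 ht1
    obtain ⟨hD1, hD2⟩ := Finset.mem_powersetCard.1 hD
    obtain ⟨hO1, hO2⟩ := Finset.mem_powersetCard.1 hO
    obtain ⟨hC1, hC2⟩ := Finset.mem_powersetCard.1 ht2
    dsimp only at hD1 hD2 hO1 hO2 hC1 hC2
    have hset : ((splittings g e a o c).filter fun x => f x = (⟨D, O⟩, C)) =
        Fintype.piFinset (splitChoices g e D O C) := by
      ext x
      rw [Fintype.mem_piFinset, Finset.mem_filter]
      simp only [mem_splitChoices hg he hO1 hD1 hC1]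
      constructor
      · rintro ⟨hx, hfx⟩ j
        obtain ⟨h1, h2, -⟩ := (Finset.mem_filter.1 hx).2
        simp only [f, Prod.mk.injEq, Sigma.mk.injEq, heq_eq_eq] at hfx
        obtain ⟨⟨h3, h4⟩, h5⟩ := hfx
        refine ⟨h1 j, h2 j, ?_, ?_, ?_⟩
        · rw [← h3]; simp
        · rw [← h4]; simp
        · rw [← h5]; simp
      · intro h
        have h3 : (Finset.univ.filter fun j => e j ≠ 0 ∧ x j ≠ 0) = D := by
          ext j; rw [(h j).2.2.1]; simp
        have h4 : (Finset.univ.filter fun j => e j ≠ 0 ∧ x j ≠ 0 ∧ (e - x) j ≠ 0) = O := by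
          ext j; rw [(h j).2.2.2.1]; simp
        have h5 : (Finset.univ.filter fun j => e j = 0 ∧ x j ≠ 0) = C := by
          ext j; rw [(h j).2.2.2.2]; simp
        refine ⟨Finset.mem_filter.2 ⟨Finset.mem_univ _, fun j => (h j).1, fun j => (h j).2.1,
          ?_, ?_, ?_⟩, ?_⟩
        · rw [h3, hD2]
        · rw [h4, hO2]
        · rw [h5, hC2]
        · simp only [f, h3, h4, h5]
    rw [hset, card_splitChoices_pi hg h7 he hO1 hD1 hC1, hO2, hC2]
  rw [Finset.sum_congr rfl hfib, Finset.sum_const, smul_eq_mul, Finset.card_product,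
    Finset.card_powersetCard, Finset.card_compl, hv, Finset.card_sigma,
    Finset.sum_congr rfl (g := fun _ => (a + o).choose o), Finset.sum_const,
    Finset.card_powersetCard, hv, smul_eq_mul]
  · ring
  · intro D hD
    rw [Finset.card_powersetCard, (Finset.mem_powersetCard.1 hD).2]

theorem card_wellFormedOn (hg : orderOf g = 6) (h7 : (7 : F) ≠ 0) (w : ℕ) :
    (wellFormedOn g ι w).card = (Fintype.card ι).choose w * 6 ^ w := by
  have h := card_splittings (ι := ι) hg h7 (e := 0) (fun j => by simp) 0 0 w
  have hset : splittings g (0 : ι → F) 0 0 w = wellFormedOn g ι w := by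
    ext x
    simp only [splittings, wellFormedOn, Finset.mem_filter, Finset.mem_univ, true_and,
      Pi.zero_apply, ne_eq, not_true_eq_false, false_and, Finset.filter_false,
      Finset.card_empty, zero_sub, Finset.mem_insert, Pi.neg_apply, neg_eq_zero,
      neg_mem_errorSet hg, add_zero, hammingNorm]
    tauto
  rw [hset] at h
  simpa using h

end Counting

section Representations

variable {F : Type w} [Field F] [DecidableEq F] {g : F}

theorem card_filter_eq_add {α : Type*} [Fintype α] (p q r : α → Prop) [DecidablePred p]
    [DecidablePred q] [DecidablePred r] (h : ∀ a, r a ↔ p a ∧ ¬ q a) :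
    (Finset.univ.filter p).card =
      (Finset.univ.filter fun a => p a ∧ q a).card + (Finset.univ.filter r).card := by
  rw [← Finset.card_filter_add_card_filter_not (s := Finset.univ.filter p) (p := q),
    Finset.filter_filter, Finset.filter_filter]
  simp only [h]

/-- The weights of the two summands of `e = x + (e - x)`, sorted by the type of position. -/
theorem hammingNorm_eq_add {ι : Type*} [Fintype ι] (e x : ι → F) :
    hammingNorm x = (Finset.univ.filter fun j => e j ≠ 0 ∧ x j ≠ 0).card +
      (Finset.univ.filter fun j => e j = 0 ∧ x j ≠ 0).card := by
  rw [hammingNorm, card_filter_eq_add (fun j => x j ≠ 0) (fun j => e j ≠ 0)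
    (fun j => e j = 0 ∧ x j ≠ 0) (fun j => by tauto)]
  simp only [and_comm]

theorem hammingNorm_sub_add {ι : Type*} [Fintype ι] (e x : ι → F) :
    hammingNorm (e - x) + (Finset.univ.filter fun j => e j ≠ 0 ∧ x j ≠ 0).card =
      hammingNorm e + (Finset.univ.filter fun j => e j ≠ 0 ∧ x j ≠ 0 ∧ (e - x) j ≠ 0).card +
      (Finset.univ.filter fun j => e j = 0 ∧ x j ≠ 0).card := by
  have h2 : hammingNorm e = (Finset.univ.filter fun j => e j ≠ 0 ∧ x j ≠ 0).card +
      (Finset.univ.filter fun j => e j ≠ 0 ∧ x j = 0).card := by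
    rw [hammingNorm, card_filter_eq_add (fun j => e j ≠ 0) (fun j => x j ≠ 0)
      (fun j => e j ≠ 0 ∧ x j = 0) (fun j => by tauto)]
  have h3 : hammingNorm (e - x) =
      (Finset.univ.filter fun j => e j ≠ 0 ∧ x j ≠ 0 ∧ (e - x) j ≠ 0).card +
      (Finset.univ.filter fun j => e j ≠ 0 ∧ x j = 0).card +
      (Finset.univ.filter fun j => e j = 0 ∧ x j ≠ 0).card := by
    rw [hammingNorm, card_filter_eq_add (fun j => (e - x) j ≠ 0) (fun j => e j ≠ 0)
      (fun j => e j = 0 ∧ x j ≠ 0)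
      (fun j => by
        simp only [Pi.sub_apply, ne_eq, not_not]
        constructor
        · rintro ⟨h4, h5⟩
          exact ⟨by simpa [h4] using h5, h4⟩
        · rintro ⟨h4, h5⟩
          exact ⟨h5, by simpa [h5] using h4⟩),
      card_filter_eq_add (fun j => (e - x) j ≠ 0 ∧ e j ≠ 0) (fun j => x j ≠ 0)
      (fun j => e j ≠ 0 ∧ x j = 0)
      (fun j => by
        simp only [Pi.sub_apply, ne_eq, not_not]
        constructor
        · rintro ⟨h4, h5⟩
          exact ⟨⟨by simpa [h5] using h4, h4⟩, h5⟩
        · tauto)]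
    congr 3
    ext j
    simp only [Finset.mem_filter]
    tauto
  omega

theorem card_support_inter_le {ι : Type*} [Fintype ι] (e x : ι → F) :
    (Finset.univ.filter fun j => e j ≠ 0 ∧ x j ≠ 0).card ≤ hammingNorm e :=
  Finset.card_le_card fun j hj => by
    simp only [Finset.mem_filter] at hj ⊢
    exact ⟨hj.1, hj.2.1⟩

variable [Fintype F]

/-- A representation is a splitting: the prescribed weights determine the number of support
positions at which only the first summand is nonzero. -/
theorem representations_eq_splittings {N v w ε b : ℕ} (hv : Even v) (hb : 2 * b ≤ v)
    (hw : w = v / 2 + ε + b) {e : Fin N → F} (he : e ∈ wellFormed g N v) :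
    representations g w ε b e = splittings g e (v / 2 - b) (2 * b) ε := by
  obtain ⟨m, hm⟩ := hv
  have hev : hammingNorm e = v := (Finset.mem_filter.1 he).2.2
  ext x
  have h1 := hammingNorm_eq_add e x
  have h2 := hammingNorm_sub_add e x
  have h4 := card_support_inter_le e x
  simp only [representations, wellFormed, splittings, Finset.mem_filter, Finset.mem_univ, true_and]
  constructor
  · rintro ⟨⟨h5, h6⟩, ⟨h7, h8⟩, h9, h10⟩
    exact ⟨h5, h7, by omega, h9, h10⟩
  · rintro ⟨h5, h6, h7, h8, h9⟩
    exact ⟨⟨h5, by omega⟩, ⟨h6, by omega⟩, h8, h9⟩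

theorem hammingNorm_of_mem_splittings {ι : Type*} [Fintype ι] [DecidableEq ι] {e x : ι → F}
    {a o c : ℕ} (hx : x ∈ splittings g e a o c) (he : hammingNorm e = 2 * a + o) :
    hammingNorm x = a + o + c ∧ hammingNorm (e - x) = a + o + c := by
  obtain ⟨-, -, h7, h8, h9⟩ := (Finset.mem_filter.1 hx).2
  have h1 := hammingNorm_eq_add e x
  have h2 := hammingNorm_sub_add e x
  omega

/-- A vector on level `i` has as many representations as there are choices of the overlap (with two
decompositions per position), of the remaining support of the first summand, and of the cancelling
positions with their entries. -/
theorem card_representations (hg : orderOf g = 6) (h7 : (7 : F) ≠ 0) {N v w ε b : ℕ} (hv : Even v)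
    (hb : 2 * b ≤ v) (hw : w = v / 2 + ε + b) {e : Fin N → F} (he : e ∈ wellFormed g N v) :
    (representations g w ε b e).card =
      trinomial v (2 * b) (v / 2 - b) * 2 ^ (2 * b) * ((N - v).choose ε * 6 ^ ε) := by
  have he' := (Finset.mem_filter.1 he).2
  rw [representations_eq_splittings hv hb hw he, card_splittings hg h7 he'.1, he'.2,
    Fintype.card_fin, trinomial, add_comm (2 * b)]

end Representations

/-! ### Splitting the positions into two halves -/

section Glue

variable {F : Type w} {ι : Type*} (p : ι → Prop) [DecidablePred p]

/-- The vector with prescribed restrictions to the positions satisfying `p` and to the others. -/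
def glue (x : {j // p j} → F) (y : {j // ¬ p j} → F) : ι → F :=
  fun j => if h : p j then x ⟨j, h⟩ else y ⟨j, h⟩

theorem glue_injective :
    Function.Injective fun xy : ({j // p j} → F) × ({j // ¬ p j} → F) => glue p xy.1 xy.2 := by
  rintro ⟨x, y⟩ ⟨x', y'⟩ h
  have h' := fun j => congrFun h j
  simp only [glue] at h'
  refine Prod.ext (funext fun ⟨j, hj⟩ => ?_) (funext fun ⟨j, hj⟩ => ?_)
  · simpa [hj] using h' j
  · simpa [hj] using h' j

theorem glue_restrict (x : ι → F) : glue p (fun j => x j) (fun j => x j) = x := by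
  ext j
  simp [glue]

variable {p}

theorem forall_glue {Q : F → Prop} {x : {j // p j} → F} {y : {j // ¬ p j} → F} :
    (∀ j, Q (glue p x y j)) ↔ (∀ j, Q (x j)) ∧ ∀ j, Q (y j) := by
  constructor
  · refine fun h => ⟨fun j => ?_, fun j => ?_⟩
    · simpa [glue, j.2] using h j
    · simpa [glue, j.2] using h j
  · rintro ⟨h1, h2⟩ j
    unfold glue
    split_ifs with h
    exacts [h1 _, h2 _]

variable [Field F]

theorem glue_add_glue (x x' : {j // p j} → F) (y y' : {j // ¬ p j} → F) :
    glue p x y + glue p x' y' = glue p (x + x') (y + y') := by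
  ext j
  simp only [glue, Pi.add_apply]
  split_ifs <;> rfl

theorem glue_sub_glue (x x' : {j // p j} → F) (y y' : {j // ¬ p j} → F) :
    glue p x y - glue p x' y' = glue p (x - x') (y - y') := by
  ext j
  simp only [glue, Pi.sub_apply]
  split_ifs <;> rfl

theorem hammingNorm_glue [Fintype ι] [DecidableEq F] (x : {j // p j} → F) (y : {j // ¬ p j} → F) :
    hammingNorm (glue p x y) = hammingNorm x + hammingNorm y := by
  simp only [hammingNorm, Finset.card_filter]
  rw [← Fintype.sum_subtype_add_sum_subtype p]
  congr 1
  · refine Finset.sum_congr rfl fun j _ => ?_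
    simp [glue, j.2]
  · refine Finset.sum_congr rfl fun j _ => ?_
    simp [glue, j.2]

end Glue

section Halves

variable {F : Type w} [Field F] [Fintype F] [DecidableEq F] {g : F} {N : ℕ}

theorem card_left (N : ℕ) : Fintype.card {j : Fin N // (j : ℕ) < N / 2} = N / 2 := by
  rw [Fintype.card_subtype]
  have := Fin.card_filter_val_lt (n := N) (m := N / 2)
  rw [this]
  omega

theorem card_right (hN : Even N) : Fintype.card {j : Fin N // ¬ (j : ℕ) < N / 2} = N / 2 := by
  obtain ⟨m, rfl⟩ := hN
  rw [Fintype.card_subtype_compl, card_left, Fintype.card_fin]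
  omega

/-- The vectors over the error set and zero of weight `m` on the first half of the positions and
weight `m'` on the second half. -/
noncomputable def balanced (g : F) (N m m' : ℕ) : Finset (Fin N → F) :=
  (wellFormedOn g {j : Fin N // (j : ℕ) < N / 2} m ×ˢ
    wellFormedOn g {j : Fin N // ¬ (j : ℕ) < N / 2} m').image fun xy => glue _ xy.1 xy.2

theorem card_balanced (hg : orderOf g = 6) (h7 : (7 : F) ≠ 0) (hN : Even N) (m m' : ℕ) :
    (balanced g N m m').card = ((N / 2).choose m * 6 ^ m) * ((N / 2).choose m' * 6 ^ m') := by
  rw [balanced, Finset.card_image_of_injective _ (glue_injective _), Finset.card_product,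
    card_wellFormedOn hg h7, card_wellFormedOn hg h7, card_left, card_right hN]

theorem mem_balanced {m m' : ℕ} {x : Fin N → F} : x ∈ balanced g N m m' ↔
    ∃ y ∈ wellFormedOn g {j : Fin N // (j : ℕ) < N / 2} m,
    ∃ z ∈ wellFormedOn g {j : Fin N // ¬ (j : ℕ) < N / 2} m', glue _ y z = x := by
  simp only [balanced, Finset.mem_image, Finset.mem_product, Prod.exists]
  constructor
  · rintro ⟨y, z, ⟨hy, hz⟩, h⟩
    exact ⟨y, hy, z, hz, h⟩
  · rintro ⟨y, hy, z, hz, h⟩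
    exact ⟨y, z, ⟨hy, hz⟩, h⟩

theorem balanced_subset {m m' w : ℕ} (hw : m + m' = w) :
    balanced g N m m' ⊆ wellFormed g N w := by
  intro x hx
  obtain ⟨y, hy, z, hz, rfl⟩ := mem_balanced.1 hx
  obtain ⟨hy1, hy2⟩ := (Finset.mem_filter.1 hy).2
  obtain ⟨hz1, hz2⟩ := (Finset.mem_filter.1 hz).2
  refine Finset.mem_filter.2 ⟨Finset.mem_univ _, ?_, ?_⟩
  · exact forall_glue.2 ⟨hy1, hz1⟩
  · rw [hammingNorm_glue, hy2, hz2, hw]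

theorem baseLeft_eq (w : ℕ) : baseLeft g N w =
    (wellFormedOn g {j : Fin N // (j : ℕ) < N / 2} w).image fun y => glue _ y 0 := by
  ext x
  simp only [baseLeft, wellFormed, wellFormedOn, Finset.mem_filter, Finset.mem_univ, true_and,
    Finset.mem_image]
  constructor
  · rintro ⟨⟨h1, h2⟩, h3⟩
    have hx : glue (fun j : Fin N => (j : ℕ) < N / 2) (fun j => x j) 0 = x := by
      conv_rhs => rw [← glue_restrict (fun j : Fin N => (j : ℕ) < N / 2) x]
      congr 1
      ext ⟨j, hj⟩
      exact (not_not.1 fun h => hj (h3 j h)).symm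
    refine ⟨fun j => x j, ⟨fun j => h1 _, ?_⟩, hx⟩
    rw [← hx, hammingNorm_glue, hammingNorm_zero, add_zero] at h2
    exact h2
  · rintro ⟨y, ⟨h1, h2⟩, rfl⟩
    refine ⟨⟨forall_glue.2 ⟨h1, fun j => by simp⟩, ?_⟩, ?_⟩
    · rw [hammingNorm_glue, hammingNorm_zero, h2, add_zero]
    · intro j hj
      by_contra h
      simp [glue, h] at hj

theorem baseRight_eq (w : ℕ) : baseRight g N w =
    (wellFormedOn g {j : Fin N // ¬ (j : ℕ) < N / 2} w).image fun y => glue _ 0 y := by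
  ext x
  simp only [baseRight, wellFormed, wellFormedOn, Finset.mem_filter, Finset.mem_univ, true_and,
    Finset.mem_image]
  constructor
  · rintro ⟨⟨h1, h2⟩, h3⟩
    have hx : glue (fun j : Fin N => (j : ℕ) < N / 2) 0 (fun j => x j) = x := by
      conv_rhs => rw [← glue_restrict (fun j : Fin N => (j : ℕ) < N / 2) x]
      congr 1
      ext ⟨j, hj⟩
      exact (not_not.1 fun h => absurd (h3 j h) (by omega)).symm
    refine ⟨fun j => x j, ⟨fun j => h1 _, ?_⟩, hx⟩
    rw [← hx, hammingNorm_glue, hammingNorm_zero, zero_add] at h2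
    exact h2
  · rintro ⟨y, ⟨h1, h2⟩, rfl⟩
    refine ⟨⟨forall_glue.2 ⟨fun j => by simp, h1⟩, ?_⟩, ?_⟩
    · rw [hammingNorm_glue, hammingNorm_zero, h2, zero_add]
    · intro j hj
      by_contra h
      simp [glue, show (j : ℕ) < N / 2 by omega] at hj

theorem card_baseLeft (hg : orderOf g = 6) (h7 : (7 : F) ≠ 0) (w : ℕ) :
    (baseLeft g N w).card = (N / 2).choose w * 6 ^ w := by
  rw [baseLeft_eq, Finset.card_image_of_injective, card_wellFormedOn hg h7, card_left]
  intro y y' h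
  exact congrArg Prod.fst (glue_injective _ (a₁ := (y, 0)) (a₂ := (y', 0)) h)

theorem card_baseRight (hg : orderOf g = 6) (h7 : (7 : F) ≠ 0) (hN : Even N) (w : ℕ) :
    (baseRight g N w).card = (N / 2).choose w * 6 ^ w := by
  rw [baseRight_eq, Finset.card_image_of_injective, card_wellFormedOn hg h7, card_right hN]
  intro y y' h
  exact congrArg Prod.snd (glue_injective _ (a₁ := (0, y)) (a₂ := (0, y')) h)

/-- Adding the entries of the two base lists is a bijection onto the balanced vectors. -/
theorem sum_baseLeft_baseRight {M : Type*} [AddCommMonoid M] (f : (Fin N → F) → M) (w : ℕ) :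
    ∑ y ∈ baseRight g N w, ∑ x ∈ baseLeft g N w, f (x + y) = ∑ z ∈ balanced g N w w, f z := by
  rw [balanced, Finset.sum_image (fun _ _ _ _ h => glue_injective _ h), Finset.sum_product_right,
    baseLeft_eq, baseRight_eq, Finset.sum_image]
  · refine Finset.sum_congr rfl fun y _ => ?_
    rw [Finset.sum_image]
    · refine Finset.sum_congr rfl fun x _ => ?_
      rw [glue_add_glue, add_zero, zero_add]
    · intro y _ y' _ h
      exact congrArg Prod.fst (glue_injective _ (a₁ := (y, 0)) (a₂ := (y', 0)) h)
  · intro y _ y' _ h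
    exact congrArg Prod.snd (glue_injective _ (a₁ := (0, y)) (a₂ := (0, y')) h)

theorem mem_balanced_iff {w : ℕ} {z : Fin N → F} : z ∈ balanced g N w w ↔
    ∃ x ∈ baseLeft g N w, ∃ y ∈ baseRight g N w, z = x + y := by
  rw [mem_balanced, baseLeft_eq, baseRight_eq]
  constructor
  · rintro ⟨y, hy, y', hy', rfl⟩
    refine ⟨_, Finset.mem_image_of_mem _ hy, _, Finset.mem_image_of_mem _ hy', ?_⟩
    rw [glue_add_glue, add_zero, zero_add]
  · rintro ⟨x, hx, y, hy, rfl⟩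
    obtain ⟨x', hx', rfl⟩ := Finset.mem_image.1 hx
    obtain ⟨y', hy', rfl⟩ := Finset.mem_image.1 hy
    refine ⟨x', hx', y', hy', ?_⟩
    rw [glue_add_glue, add_zero, zero_add]

/-- The number of splittings of a vector of weight `2 * a + o` on `H` positions, with `c`
cancelling positions. -/
def splitCount (H a o c : ℕ) : ℕ :=
  (2 * a + o).choose (a + o) * (a + o).choose o * 2 ^ o * ((H - (2 * a + o)).choose c * 6 ^ c)

/-- A vector whose two halves have the weights `2 * a + o` and `2 * a' + o` has many decompositions
into two summands which both have weight `m` on either half: split the halves separately. -/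
theorem exists_balanced_splittings (hg : orderOf g = 6) (h7 : (7 : F) ≠ 0) (hN : Even N)
    {a a' o c c' m : ℕ} (h1 : a + o + c = m) (h2 : a' + o + c' = m) {e : Fin N → F}
    (he : e ∈ balanced g N (2 * a + o) (2 * a' + o)) :
    ∃ S : Finset (Fin N → F), S.card = splitCount (N / 2) a o c * splitCount (N / 2) a' o c' ∧
      ∀ x ∈ S, x ∈ balanced g N m m ∧ e - x ∈ balanced g N m m := by
  obtain ⟨y, hy, z, hz, rfl⟩ := mem_balanced.1 he
  obtain ⟨hy1, hy2⟩ := (Finset.mem_filter.1 hy).2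
  obtain ⟨hz1, hz2⟩ := (Finset.mem_filter.1 hz).2
  refine ⟨(splittings g y a o c ×ˢ splittings g z a' o c').image fun xy => glue _ xy.1 xy.2,
    ?_, ?_⟩
  · rw [Finset.card_image_of_injective _ (glue_injective _), Finset.card_product,
      card_splittings hg h7 hy1, card_splittings hg h7 hz1, card_left, card_right hN, hy2, hz2,
      splitCount, splitCount]
  · intro x hx
    obtain ⟨⟨x1, x2⟩, hx12, rfl⟩ := Finset.mem_image.1 hx
    obtain ⟨hx1, hx2⟩ := Finset.mem_product.1 hx12
    have n1 := hammingNorm_of_mem_splittings hx1 hy2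
    have n2 := hammingNorm_of_mem_splittings hx2 hz2
    have m1 := (Finset.mem_filter.1 hx1).2
    have m2 := (Finset.mem_filter.1 hx2).2
    rw [h1] at n1
    rw [h2] at n2
    constructor
    · exact mem_balanced.2 ⟨x1, Finset.mem_filter.2 ⟨Finset.mem_univ _, m1.1, n1.1⟩,
        x2, Finset.mem_filter.2 ⟨Finset.mem_univ _, m2.1, n2.1⟩, rfl⟩
    · rw [glue_sub_glue]
      exact mem_balanced.2 ⟨y - x1, Finset.mem_filter.2 ⟨Finset.mem_univ _, m1.2.1, n1.2⟩,
        z - x2, Finset.mem_filter.2 ⟨Finset.mem_univ _, m2.2.1, n2.2⟩, rfl⟩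

end Halves

/-! ### Random matrices -/

section Random

variable {F : Type w} [Fintype F] {N l : ℕ}

/-- The expectation of a function of a uniformly random matrix. -/
noncomputable def expect (f : Matrix (Fin N) (Fin l) F → ℝ) : ℝ :=
  (∑ A, f A) / (Fintype.card (Matrix (Fin N) (Fin l) F) : ℝ)

theorem expect_mono {f f' : Matrix (Fin N) (Fin l) F → ℝ} (h : ∀ A, f A ≤ f' A) :
    expect f ≤ expect f' :=
  div_le_div_of_nonneg_right (Finset.sum_le_sum fun A _ => h A) (Nat.cast_nonneg _)

theorem expect_nonneg {f : Matrix (Fin N) (Fin l) F → ℝ} (h : ∀ A, 0 ≤ f A) : 0 ≤ expect f :=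
  div_nonneg (Finset.sum_nonneg fun A _ => h A) (Nat.cast_nonneg _)

theorem expect_add (f f' : Matrix (Fin N) (Fin l) F → ℝ) :
    expect (fun A => f A + f' A) = expect f + expect f' := by
  simp only [expect, Finset.sum_add_distrib, add_div]

theorem expect_const_mul (c : ℝ) (f : Matrix (Fin N) (Fin l) F → ℝ) :
    expect (fun A => c * f A) = c * expect f := by
  simp only [expect, ← Finset.mul_sum, mul_div_assoc]

theorem expect_const [Nonempty F] (c : ℝ) : expect (fun _ : Matrix (Fin N) (Fin l) F => c) = c := by
  have : Nonempty (Matrix (Fin N) (Fin l) F) := inferInstanceAs (Nonempty (Fin N → Fin l → F))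
  have : (Fintype.card (Matrix (Fin N) (Fin l) F) : ℝ) ≠ 0 := by
    exact_mod_cast Fintype.card_ne_zero
  simp only [expect, Finset.sum_const, Finset.card_univ, nsmul_eq_mul]
  field_simp

theorem expect_sum {κ : Type*} (S : Finset κ) (f : κ → Matrix (Fin N) (Fin l) F → ℝ) :
    expect (fun A => ∑ i ∈ S, f i A) = ∑ i ∈ S, expect (f i) := by
  simp only [expect]
  rw [Finset.sum_comm, Finset.sum_div]

/-- The probability that a uniformly random vector of length `l` has prescribed entries on the
first `p` positions. -/
noncomputable def matchProb (F : Type w) [Fintype F] (l p : ℕ) : ℝ :=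
  ((Fintype.card F : ℝ) ^ min p l)⁻¹

theorem matchProb_pos [Nonempty F] (p : ℕ) : 0 < matchProb F l p :=
  inv_pos.2 (pow_pos (by exact_mod_cast Fintype.card_pos) _)

section Field

variable {F : Type w} [Field F] {N l : ℕ}

/-- The functions of a matrix `A` which only depend on the products `z A` with `z ∈ Z`. -/
def DeterminedBy (Z : Finset (Fin N → F)) (f : Matrix (Fin N) (Fin l) F → ℝ) : Prop :=
  ∀ A A', (∀ z ∈ Z, Matrix.vecMul z A = Matrix.vecMul z A') → f A = f A'

open Classical in
/-- The indicator function of the event that `x A` agrees with `t` on the first `p` positions. -/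
noncomputable def ind (p : ℕ) (t : Fin l → F) (x : Fin N → F) (A : Matrix (Fin N) (Fin l) F) : ℝ :=
  if Matches A p t x then 1 else 0

theorem ind_nonneg (p : ℕ) (t : Fin l → F) (x : Fin N → F) (A : Matrix (Fin N) (Fin l) F) :
    0 ≤ ind p t x A := by
  unfold ind
  split_ifs <;> norm_num

theorem ind_mul_self (p : ℕ) (t : Fin l → F) (x : Fin N → F) (A : Matrix (Fin N) (Fin l) F) :
    ind p t x A * ind p t x A = ind p t x A := by
  unfold ind
  split_ifs <;> norm_num

theorem DeterminedBy.mul_ind [DecidableEq F] {Z : Finset (Fin N → F)} {f : Matrix (Fin N) (Fin l) F → ℝ}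
    (hf : DeterminedBy Z f) (p : ℕ) (t : Fin l → F) (x : Fin N → F) :
    DeterminedBy (insert x Z) (fun A => f A * ind p t x A) := by
  intro A A' h
  have h1 := hf A A' fun z hz => h z (Finset.mem_insert_of_mem hz)
  have h2 := h x (Finset.mem_insert_self _ _)
  simp only [h1, ind, Matches, h2]
  congr

theorem determinedBy_const (c : ℝ) :
    DeterminedBy ∅ (fun _ : Matrix (Fin N) (Fin l) F => c) := fun _ _ _ => rfl

/-- The number of vectors in `S` which match the target `t` on the first `p` positions. -/
noncomputable def matchCount (p : ℕ) (St : Finset (Fin N → F) × (Fin l → F))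
    (A : Matrix (Fin N) (Fin l) F) : ℝ :=
  ∑ x ∈ St.1, ind p St.2 x A

theorem matchCount_nonneg (p : ℕ) (St : Finset (Fin N → F) × (Fin l → F))
    (A : Matrix (Fin N) (Fin l) F) : 0 ≤ matchCount p St A :=
  Finset.sum_nonneg fun _ _ => ind_nonneg _ _ _ _

end Field

variable [Field F]

open Classical in
theorem card_agreeing (p : ℕ) (c : Fin l → F) :
    ((Finset.univ.filter fun d : Fin l → F => ∀ j : Fin l, (j : ℕ) < p → d j = c j).card : ℝ) =
      (Fintype.card F : ℝ) ^ l * matchProb F l p := by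
  have h : (Finset.univ.filter fun d : Fin l → F => ∀ j : Fin l, (j : ℕ) < p → d j = c j) =
      Fintype.piFinset fun j : Fin l => if (j : ℕ) < p then {c j} else Finset.univ := by
    ext d
    simp only [Finset.mem_filter, Finset.mem_univ, true_and, Fintype.mem_piFinset]
    refine forall_congr' fun j => ?_
    split_ifs with h <;> simp [h]
  have hq : (Fintype.card F : ℝ) ≠ 0 := by exact_mod_cast Fintype.card_ne_zero
  rw [h, Fintype.card_piFinset]
  have h2 : ∀ j : Fin l, (if (j : ℕ) < p then {c j} else (Finset.univ : Finset F)).card =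
      if ¬ (j : ℕ) < p then Fintype.card F else 1 := by
    intro j
    split_ifs <;> simp
  simp only [h2]
  rw [← Finset.prod_filter, Finset.prod_const]
  have h3 := Finset.card_filter_add_card_filter_not (s := (Finset.univ : Finset (Fin l)))
    (p := fun j : Fin l => (j : ℕ) < p)
  rw [Fin.card_filter_val_lt, Finset.card_univ, Fintype.card_fin] at h3
  have h4 : (Finset.univ.filter fun j : Fin l => ¬ (j : ℕ) < p).card = l - min p l := by
    rw [min_comm]; omega
  rw [h4, matchProb, Nat.cast_pow, ← div_eq_mul_inv,
    eq_div_iff (pow_ne_zero _ hq), ← pow_add]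
  congr 1
  have := min_le_right p l
  omega

/-- A vector outside the span of `Z` has an independent, uniformly distributed syndrome: adding to
the random matrix a multiple of a functional that vanishes on `Z` shifts this syndrome
arbitrarily and leaves the products with the elements of `Z` unchanged. -/
theorem expect_mul_ind {Z : Finset (Fin N → F)} {f : Matrix (Fin N) (Fin l) F → ℝ}
    (hf : DeterminedBy Z f) (p : ℕ) (t : Fin l → F) {x : Fin N → F}
    (hx : x ∉ Submodule.span F (Z : Set (Fin N → F))) :
    expect (fun A => f A * ind p t x A) = expect f * matchProb F l p := by
  classical
  obtain ⟨φ, hφx, hφZ⟩ := Submodule.exists_le_ker_of_notMem hx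
  set v : Fin N → F := fun i => φ (Pi.single i 1) with hv
  have hdot : ∀ z : Fin N → F, z ⬝ᵥ v = φ z := by
    intro z
    rw [LinearMap.pi_apply_eq_sum_univ φ z]
    simp only [dotProduct, smul_eq_mul, hv]
    refine Finset.sum_congr rfl fun i _ => ?_
    congr 2
    ext j
    simp [Pi.single_apply, eq_comm]
  have hshift : ∀ (d : Fin l → F) (z : Fin N → F) (A : Matrix (Fin N) (Fin l) F),
      Matrix.vecMul z (A + Matrix.vecMulVec v d) = Matrix.vecMul z A + φ z • d := by
    intro d z A
    rw [Matrix.vecMul_add, Matrix.vecMul_vecMulVec, hdot]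
  have key : ∀ d : Fin l → F, (∑ A, f A * ind p t x A) =
      ∑ A, f A * if (∀ j : Fin l, (j : ℕ) < p →
        d j = (φ x)⁻¹ * (t j - Matrix.vecMul x A j)) then 1 else 0 := by
    intro d
    rw [← Equiv.sum_comp (Equiv.addRight (Matrix.vecMulVec v d)) fun A => f A * ind p t x A]
    refine Finset.sum_congr rfl fun A _ => ?_
    simp only [Equiv.coe_addRight]
    congr 1
    · refine hf _ _ fun z hz => ?_
      have : φ z = 0 := hφZ (Submodule.subset_span hz)
      rw [hshift, this, zero_smul, add_zero]
    · have : Matches (A + Matrix.vecMulVec v d) p t x ↔ ∀ j : Fin l, (j : ℕ) < p →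
          d j = (φ x)⁻¹ * (t j - Matrix.vecMul x A j) := ?_
      · simp only [ind, this]
      refine forall_congr' fun j => forall_congr' fun _ => ?_
      rw [hshift, Pi.add_apply, Pi.smul_apply, smul_eq_mul, eq_inv_mul_iff_mul_eq₀ hφx,
        eq_sub_iff_add_eq, add_comm]
  have hq : (0 : ℝ) < (Fintype.card F : ℝ) ^ l :=
    pow_pos (by exact_mod_cast Fintype.card_pos) _
  have hsum : (Fintype.card F : ℝ) ^ l * (∑ A, f A * ind p t x A) =
      (Fintype.card F : ℝ) ^ l * ((∑ A, f A) * matchProb F l p) := by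
    have h1 : (∑ _d : Fin l → F, ∑ A, f A * ind p t x A) =
        (Fintype.card F : ℝ) ^ l * (∑ A, f A * ind p t x A) := by
      rw [Finset.sum_const, Finset.card_univ, Fintype.card_fun, Fintype.card_fin, nsmul_eq_mul,
        Nat.cast_pow]
    rw [← h1, Finset.sum_congr rfl fun d _ => key d, Finset.sum_comm]
    have h2 : ∀ A : Matrix (Fin N) (Fin l) F, (∑ d : Fin l → F, f A *
        if (∀ j : Fin l, (j : ℕ) < p → d j = (φ x)⁻¹ * (t j - Matrix.vecMul x A j))
          then (1 : ℝ) else 0) = f A * ((Fintype.card F : ℝ) ^ l * matchProb F l p) := by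
      intro A
      rw [← Finset.mul_sum, Finset.sum_boole,
        card_agreeing p fun j => (φ x)⁻¹ * (t j - Matrix.vecMul x A j)]
    rw [Finset.sum_congr rfl fun A _ => h2 A, ← Finset.sum_mul]
    ring
  have := mul_left_cancel₀ hq.ne' hsum
  rw [expect, this, expect]
  ring

open Classical in
theorem card_filter_mem_span_le {κ : Type*} (Z : Finset (Fin N → F)) (S : Finset κ)
    {v : κ → Fin N → F} (hv : Set.InjOn v S) {K : ℕ} (hZ : Z.card ≤ K) :
    ((S.filter fun i => v i ∈ Submodule.span F (Z : Set (Fin N → F))).card : ℝ) ≤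
      (Fintype.card F : ℝ) ^ K := by
  have h1 : (S.filter fun i => v i ∈ Submodule.span F (Z : Set (Fin N → F))).card ≤
      (Finset.univ.filter fun x => x ∈ Submodule.span F (Z : Set (Fin N → F))).card := by
    refine Finset.card_le_card_of_injOn v (fun i hi => ?_) (hv.mono fun i hi => ?_)
    · simp only [Finset.coe_filter, Set.mem_ofPred_eq] at hi
      simpa using hi.2
    · simp only [Finset.coe_filter, Set.mem_ofPred_eq] at hi
      exact hi.1
  have h2 : (Finset.univ.filter fun x => x ∈ Submodule.span F (Z : Set (Fin N → F))).card =
      Fintype.card F ^ Module.finrank F (Submodule.span F (Z : Set (Fin N → F))) := by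
    rw [← Fintype.card_subtype, ← Module.card_eq_pow_finrank]
  have h3 : Module.finrank F (Submodule.span F (Z : Set (Fin N → F))) ≤ K :=
    (finrank_span_finset_le_card Z).trans hZ
  have h4 := h1.trans (h2.le.trans (Nat.pow_le_pow_right Fintype.card_pos h3))
  exact_mod_cast h4

theorem expect_mul_sum_ind_eq {κ : Type*} (f : Matrix (Fin N) (Fin l) F → ℝ) (p : ℕ)
    (t : Fin l → F) (S : Finset κ) (v : κ → Fin N → F) :
    expect (fun A => f A * ∑ i ∈ S, ind p t (v i) A) =
      ∑ i ∈ S, expect (fun A => f A * ind p t (v i) A) := by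
  simp only [Finset.mul_sum]
  exact expect_sum S fun i A => f A * ind p t (v i) A

/-- Up to the few vectors in the span of `Z`, the number of matching vectors has the expected
value. -/
theorem expect_mul_sum_ind_le {κ : Type*} {Z : Finset (Fin N → F)}
    {f : Matrix (Fin N) (Fin l) F → ℝ} (hf : DeterminedBy Z f) (hf0 : ∀ A, 0 ≤ f A) (p : ℕ)
    (t : Fin l → F) (S : Finset κ) {v : κ → Fin N → F} (hv : Set.InjOn v S) {K : ℕ}
    (hZ : Z.card ≤ K) :
    expect (fun A => f A * ∑ i ∈ S, ind p t (v i) A) ≤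
      ((Fintype.card F : ℝ) ^ K + S.card * matchProb F l p) * expect f := by
  classical
  have hE := expect_nonneg hf0
  rw [expect_mul_sum_ind_eq,
    ← Finset.sum_filter_add_sum_filter_not S
      (fun i => v i ∈ Submodule.span F (Z : Set (Fin N → F))), add_mul]
  refine add_le_add ?_ ?_
  · refine (Finset.sum_le_card_nsmul _ _ (expect f) fun i _ => ?_).trans ?_
    · refine expect_mono fun A => ?_
      refine mul_le_of_le_one_right (hf0 A) ?_
      unfold ind
      split_ifs <;> norm_num
    · rw [nsmul_eq_mul]
      exact mul_le_mul_of_nonneg_right (card_filter_mem_span_le Z S hv hZ) hE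
  · rw [Finset.sum_congr rfl (g := fun _ => expect f * matchProb F l p), Finset.sum_const,
      nsmul_eq_mul]
    · have : ((S.filter fun i => v i ∉ Submodule.span F (Z : Set (Fin N → F))).card : ℝ) ≤
          S.card := by exact_mod_cast Finset.card_filter_le _ _
      have h2 := (matchProb_pos (F := F) (l := l) p).le
      calc _ ≤ (S.card : ℝ) * (expect f * matchProb F l p) :=
            mul_le_mul_of_nonneg_right this (mul_nonneg hE h2)
        _ = _ := by ring
    · intro i hi
      exact expect_mul_ind hf p t (Finset.mem_filter.1 hi).2

theorem le_expect_mul_sum_ind {κ : Type*} {Z : Finset (Fin N → F)}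
    {f : Matrix (Fin N) (Fin l) F → ℝ} (hf : DeterminedBy Z f) (hf0 : ∀ A, 0 ≤ f A) (p : ℕ)
    (t : Fin l → F) (S : Finset κ) {v : κ → Fin N → F} (hv : Set.InjOn v S) {K : ℕ}
    (hZ : Z.card ≤ K) :
    (S.card - (Fintype.card F : ℝ) ^ K) * matchProb F l p * expect f ≤
      expect (fun A => f A * ∑ i ∈ S, ind p t (v i) A) := by
  classical
  have hE := expect_nonneg hf0
  rw [expect_mul_sum_ind_eq,
    ← Finset.sum_filter_add_sum_filter_not S
      (fun i => v i ∈ Submodule.span F (Z : Set (Fin N → F)))]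
  refine le_add_of_nonneg_of_le ?_ ?_
  · exact Finset.sum_nonneg fun i _ => expect_nonneg fun A => mul_nonneg (hf0 A) (ind_nonneg _ _ _ _)
  · rw [Finset.sum_congr rfl (g := fun _ => expect f * matchProb F l p), Finset.sum_const,
      nsmul_eq_mul]
    · have h1 := card_filter_mem_span_le Z S hv hZ
      have h3 : ((S.filter fun i => v i ∈ Submodule.span F (Z : Set (Fin N → F))).card : ℝ) +
          ((S.filter fun i => v i ∉ Submodule.span F (Z : Set (Fin N → F))).card : ℝ) =
            S.card := by exact_mod_cast Finset.card_filter_add_card_filter_not _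
      have h2 := (matchProb_pos (F := F) (l := l) p).le
      calc _ = (S.card - (Fintype.card F : ℝ) ^ K) * (expect f * matchProb F l p) := by ring
        _ ≤ _ := mul_le_mul_of_nonneg_right (by linarith) (mul_nonneg hE h2)
    · intro i hi
      exact expect_mul_ind hf p t (Finset.mem_filter.1 hi).2

variable [DecidableEq F]

/-- Mixed moments of numbers of matching vectors, from above. -/
theorem expect_mul_prod_matchCount_le (p : ℕ) {M : ℕ} {K : ℕ}
    (L : List (Finset (Fin N → F) × (Fin l → F))) (hL : ∀ St ∈ L, St.1.card = M) :
    ∀ (Z : Finset (Fin N → F)) (f : Matrix (Fin N) (Fin l) F → ℝ), DeterminedBy Z f →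
      (∀ A, 0 ≤ f A) → Z.card + L.length ≤ K →
      expect (fun A => f A * (L.map fun St => matchCount p St A).prod) ≤
        ((Fintype.card F : ℝ) ^ K + M * matchProb F l p) ^ L.length * expect f := by
  induction L with
  | nil => intro Z f _ _ _; simp
  | cons St L ih =>
    intro Z f hf hf0 hK
    rw [List.length_cons] at hK ⊢
    have hpos : 0 ≤ (Fintype.card F : ℝ) ^ K + M * matchProb F l p :=
      add_nonneg (by positivity) (mul_nonneg (by positivity) (matchProb_pos p).le)
    have h1 : ∀ A, f A * ((St :: L).map fun St => matchCount p St A).prod =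
        ∑ x ∈ St.1, (f A * ind p St.2 x A) * (L.map fun St => matchCount p St A).prod := by
      intro A
      rw [List.map_cons, List.prod_cons, matchCount, ← Finset.sum_mul, ← Finset.mul_sum, mul_assoc]
    simp only [h1]
    rw [expect_sum]
    calc _ ≤ ∑ x ∈ St.1, ((Fintype.card F : ℝ) ^ K + M * matchProb F l p) ^ L.length *
          expect (fun A => f A * ind p St.2 x A) := by
          refine Finset.sum_le_sum fun x _ => ?_
          refine ih (fun St h => hL St (List.mem_cons_of_mem _ h)) _ _ (hf.mul_ind p St.2 x)
            (fun A => mul_nonneg (hf0 A) (ind_nonneg _ _ _ _)) ?_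
          have := Finset.card_insert_le x Z
          omega
      _ ≤ _ := by
          have h2 := expect_mul_sum_ind_le hf hf0 p St.2 St.1 (v := id) Function.injective_id.injOn
            (K := K) (by omega)
          rw [expect_mul_sum_ind_eq, hL St List.mem_cons_self] at h2
          rw [← Finset.mul_sum, pow_succ, mul_assoc]
          exact mul_le_mul_of_nonneg_left h2 (pow_nonneg hpos _)

/-- Mixed moments of numbers of matching vectors, from below. -/
theorem le_expect_mul_prod_matchCount (p : ℕ) {M : ℕ} {K : ℕ}
    (hM : (Fintype.card F : ℝ) ^ K ≤ M)
    (L : List (Finset (Fin N → F) × (Fin l → F))) (hL : ∀ St ∈ L, St.1.card = M) :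
    ∀ (Z : Finset (Fin N → F)) (f : Matrix (Fin N) (Fin l) F → ℝ), DeterminedBy Z f →
      (∀ A, 0 ≤ f A) → Z.card + L.length ≤ K →
      ((M - (Fintype.card F : ℝ) ^ K) * matchProb F l p) ^ L.length * expect f ≤
        expect (fun A => f A * (L.map fun St => matchCount p St A).prod) := by
  induction L with
  | nil => intro Z f _ _ _; simp
  | cons St L ih =>
    intro Z f hf hf0 hK
    rw [List.length_cons] at hK ⊢
    have hpos : 0 ≤ (M - (Fintype.card F : ℝ) ^ K) * matchProb F l p :=
      mul_nonneg (by linarith) (matchProb_pos p).le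
    have h1 : ∀ A, f A * ((St :: L).map fun St => matchCount p St A).prod =
        ∑ x ∈ St.1, (f A * ind p St.2 x A) * (L.map fun St => matchCount p St A).prod := by
      intro A
      rw [List.map_cons, List.prod_cons, matchCount, ← Finset.sum_mul, ← Finset.mul_sum, mul_assoc]
    simp only [h1]
    rw [expect_sum]
    calc _ ≤ ∑ x ∈ St.1, ((M - (Fintype.card F : ℝ) ^ K) * matchProb F l p) ^ L.length *
          expect (fun A => f A * ind p St.2 x A) := by
          have h2 := le_expect_mul_sum_ind hf hf0 p St.2 St.1 (v := id) Function.injective_id.injOn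
            (K := K) (by omega)
          rw [expect_mul_sum_ind_eq, hL St List.mem_cons_self] at h2
          rw [← Finset.mul_sum, pow_succ, mul_assoc]
          exact mul_le_mul_of_nonneg_left h2 (pow_nonneg hpos _)
      _ ≤ _ := by
          refine Finset.sum_le_sum fun x _ => ?_
          refine ih (fun St h => hL St (List.mem_cons_of_mem _ h)) _ _ (hf.mul_ind p St.2 x)
            (fun A => mul_nonneg (hf0 A) (ind_nonneg _ _ _ _)) ?_
          have := Finset.card_insert_le x Z
          omega

/-- The second moment method: conditionally on an event determined by few vectors, two large sets
both contain a matching vector with a probability that is bounded below in terms of the expected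
numbers of matching vectors. -/
theorem expect_both_match_ge (p : ℕ) {M : ℕ} {K : ℕ} (hM : (Fintype.card F : ℝ) ^ K ≤ M)
    {Z : Finset (Fin N → F)} (hZ : Z.card + 4 ≤ K) {f : Matrix (Fin N) (Fin l) F → ℝ}
    (hf : DeterminedBy Z f) (hf0 : ∀ A, 0 ≤ f A) (hf2 : ∀ A, f A * f A = f A)
    {St St' : Finset (Fin N → F) × (Fin l → F)} (hS : St.1.card = M) (hS' : St'.1.card = M) :
    ((M - (Fintype.card F : ℝ) ^ K) * matchProb F l p) ^ 4 /
        ((Fintype.card F : ℝ) ^ K + M * matchProb F l p) ^ 4 * expect f ≤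
      expect (fun A => f A *
        if 0 < matchCount p St A ∧ 0 < matchCount p St' A then 1 else 0) := by
  set I : Matrix (Fin N) (Fin l) F → ℝ := fun A =>
    if 0 < matchCount p St A ∧ 0 < matchCount p St' A then 1 else 0 with hI
  have hlow := le_expect_mul_prod_matchCount p hM [St, St'] (by simp [hS, hS']) Z f hf hf0
    (by simp; omega)
  have hup := expect_mul_prod_matchCount_le (M := M) (K := K) p [St, St', St, St'] (by simp [hS, hS']) Z f
    hf hf0 (by simpa using hZ)
  simp only [List.map_cons, List.map_nil, List.prod_cons, List.prod_nil, mul_one, List.length_cons,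
    List.length_nil, zero_add, Nat.reduceAdd] at hlow hup
  set X : Matrix (Fin N) (Fin l) F → ℝ := fun A => matchCount p St A * matchCount p St' A with hX
  have hIX : ∀ A, I A * X A = X A := by
    intro A
    simp only [hI, hX]
    split_ifs with h
    · rw [one_mul]
    · rw [zero_mul]
      have h1 := matchCount_nonneg p St A
      have h2 := matchCount_nonneg p St' A
      rw [not_and_or, not_lt, not_lt] at h
      rcases h with h | h
      · rw [le_antisymm h h1, zero_mul]
      · rw [le_antisymm h h2, mul_zero]
  have hI0 : ∀ A, 0 ≤ I A := fun A => by simp only [hI]; split_ifs <;> norm_num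
  have hII : ∀ A, I A * I A = I A := fun A => by simp only [hI]; split_ifs <;> norm_num
  have hCS : expect (fun A => f A * X A) ^ 2 ≤
      expect (fun A => f A * I A) * expect (fun A => f A * (X A * X A)) := by
    have h1 := Finset.sum_mul_sq_le_sq_mul_sq (Finset.univ : Finset (Matrix (Fin N) (Fin l) F))
      (fun A => f A * I A) (fun A => f A * X A)
    have h2 : ∀ A, f A * I A * (f A * X A) = f A * X A := fun A => by
      rw [mul_mul_mul_comm, hf2, hIX]
    have h3 : ∀ A, (f A * I A) ^ 2 = f A * I A := fun A => by
      rw [sq, mul_mul_mul_comm, hf2, hII]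
    have h4 : ∀ A, (f A * X A) ^ 2 = f A * (X A * X A) := fun A => by
      rw [sq, mul_mul_mul_comm, hf2]
    simp only [h2, h3, h4] at h1
    unfold expect
    rw [div_pow, div_mul_div_comm, ← sq]
    exact div_le_div_of_nonneg_right h1 (sq_nonneg _)
  have hE := expect_nonneg hf0
  have hEI : 0 ≤ expect (fun A => f A * I A) :=
    expect_nonneg fun A => mul_nonneg (hf0 A) (hI0 A)
  have hup' : expect (fun A => f A * (X A * X A)) ≤
      ((Fintype.card F : ℝ) ^ K + M * matchProb F l p) ^ 4 * expect f := by
    refine le_trans (le_of_eq ?_) hup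
    congr 1
    ext A
    simp only [hX]
    ring
  set a := (M - (Fintype.card F : ℝ) ^ K) * matchProb F l p with ha
  set b := (Fintype.card F : ℝ) ^ K + M * matchProb F l p with hb
  have ha0 : 0 ≤ a := mul_nonneg (by linarith) (matchProb_pos p).le
  have hb0 : 0 < b := add_pos_of_pos_of_nonneg (pow_pos (by exact_mod_cast Fintype.card_pos) _)
    (mul_nonneg (by positivity) (matchProb_pos p).le)
  rcases hE.eq_or_lt with h0 | h0
  · rw [← h0, mul_zero]
    exact hEI
  · rw [div_mul_eq_mul_div, div_le_iff₀ (by positivity)]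
    have h1 : (a ^ 2 * expect f) ^ 2 ≤ expect (fun A => f A * I A) * (b ^ 4 * expect f) :=
      (pow_le_pow_left₀ (by positivity) hlow 2).trans
        (hCS.trans (mul_le_mul_of_nonneg_left hup' hEI))
    have h2 : (a ^ 4 * expect f) * expect f ≤
        (expect (fun A => f A * I A) * b ^ 4) * expect f := by
      calc _ = (a ^ 2 * expect f) ^ 2 := by ring
        _ ≤ _ := h1
        _ = _ := by ring
    exact le_of_mul_le_mul_right h2 h0

end Random

/-! ### The expected number of steps -/

section Cost

variable {F : Type w} [Field F] {N l : ℕ}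

/-- The number of colliding pairs in a merge. -/
noncomputable def collisions (p : ℕ) (t : Fin l → F) (L₁ L₂ : Finset (Fin N → F))
    (A : Matrix (Fin N) (Fin l) F) : ℝ :=
  ∑ y ∈ L₂, ∑ x ∈ L₁, ind p t (x + y) A

theorem collisions_nonneg (p : ℕ) (t : Fin l → F) (L₁ L₂ : Finset (Fin N → F))
    (A : Matrix (Fin N) (Fin l) F) : 0 ≤ collisions p t L₁ L₂ A :=
  Finset.sum_nonneg fun _ _ => Finset.sum_nonneg fun _ _ => ind_nonneg _ _ _ _

theorem ind_of_matches {p : ℕ} {t : Fin l → F} {x : Fin N → F} {A : Matrix (Fin N) (Fin l) F}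
    (h : Matches A p t x) : ind p t x A = 1 := if_pos h

theorem matches_of_ind_pos {p : ℕ} {t : Fin l → F} {x : Fin N → F} {A : Matrix (Fin N) (Fin l) F}
    (h : 0 < ind p t x A) : Matches A p t x := by
  by_contra h'
  rw [ind, if_neg h'] at h
  exact lt_irrefl _ h

theorem Matches.add {A : Matrix (Fin N) (Fin l) F} {p : ℕ} {t t' : Fin l → F} {x y : Fin N → F}
    (hx : Matches A p t x) (hy : Matches A p t' y) : Matches A p (t + t') (x + y) := by
  intro j hj
  rw [Matrix.add_vecMul, Pi.add_apply, Pi.add_apply, hx j hj, hy j hj]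

theorem Matches.sub {A : Matrix (Fin N) (Fin l) F} {p : ℕ} {t t' : Fin l → F} {x y : Fin N → F}
    (hx : Matches A p t x) (hy : Matches A p t' y) : Matches A p (t - t') (x - y) := by
  intro j hj
  rw [Matrix.sub_vecMul, Pi.sub_apply, Pi.sub_apply, hx j hj, hy j hj]

theorem Matches.mono {A : Matrix (Fin N) (Fin l) F} {p p' : ℕ} {t : Fin l → F} {x : Fin N → F}
    (hx : Matches A p t x) (h : p' ≤ p) : Matches A p' t x := fun j hj => hx j (hj.trans_le h)

/-- The condition on a pair in a representation merge, in terms of the first summand and the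
sum. -/
theorem matches_pair_iff {A : Matrix (Fin N) (Fin l) F} {u u' : ℕ} {t : Fin l → F}
    {x y : Fin N → F} : Matches A u t x ∧ Matches A u 0 y ∧ Matches A u' t (x + y) ↔
      Matches A u t x ∧ Matches A (max u' u) t (x + y) := by
  constructor
  · rintro ⟨hx, hy, hxy⟩
    refine ⟨hx, fun j hj => ?_⟩
    rcases lt_max_iff.1 hj with h | h
    · exact hxy j h
    · have := hx.add hy
      rw [add_zero] at this
      exact this j h
  · rintro ⟨hx, hxy⟩
    refine ⟨hx, ?_, hxy.mono (le_max_left _ _)⟩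
    have := (hxy.mono (le_max_right _ _)).sub hx
    rwa [sub_self, add_sub_cancel_left] at this

open Classical in
theorem sum_filter_matches (A : Matrix (Fin N) (Fin l) F) (p : ℕ) (t : Fin l → F)
    (D : Finset (Fin N → F)) (f : (Fin N → F) → ℝ) :
    ∑ x ∈ D.filter (fun x => Matches A p t x), f x = ∑ x ∈ D, ind p t x A * f x := by
  rw [Finset.sum_filter]
  refine Finset.sum_congr rfl fun x _ => ?_
  unfold ind
  split_ifs <;> simp

open Classical in
/-- The collisions in the merge of two lists that were obtained from `D` by matching on `u`
positions. -/
theorem collisions_filter (A : Matrix (Fin N) (Fin l) F) (u u' : ℕ) (t : Fin l → F)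
    (D : Finset (Fin N → F)) :
    collisions u' t (D.filter fun x => Matches A u t x) (D.filter fun x => Matches A u 0 x) A =
      ∑ x ∈ D, ind u t x A * ∑ y ∈ D, ind (max u' u) t (x + y) A := by
  rw [collisions, sum_filter_matches]
  simp only [sum_filter_matches, Finset.mul_sum]
  rw [Finset.sum_comm]
  refine Finset.sum_congr rfl fun x _ => Finset.sum_congr rfl fun y _ => ?_
  have h := matches_pair_iff (A := A) (u := u) (u' := u') (t := t) (x := x) (y := y)
  unfold ind
  by_cases h1 : Matches A u t x
  · simp only [h1, true_and] at h
    simp only [h1, if_true, one_mul, ← h]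
    by_cases h2 : Matches A u 0 y <;> simp [h2]
  · simp [h1]

theorem injOn_const_add (x : Fin N → F) (S : Set (Fin N → F)) : Set.InjOn (fun y => x + y) S :=
  (add_right_injective x).injOn

section Merge

variable [DecidableEq F]

theorem merge_steps (A : Matrix (Fin N) (Fin l) F) (p : ℕ) (t : Fin l → F)
    (W L₁ L₂ : Finset (Fin N → F)) :
    ((merge A p t W L₁ L₂).steps : ℝ) = L₁.card + L₂.card + collisions p t L₁ L₂ A := by
  classical
  simp only [merge, Nat.cast_add, Nat.cast_sum, Finset.sum_add_distrib,
    Finset.sum_const, nsmul_eq_mul, mul_one, collisions, ind, Finset.sum_boole, add_assoc]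
  congr

theorem mem_merge {A : Matrix (Fin N) (Fin l) F} {p : ℕ} {t : Fin l → F}
    {W L₁ L₂ : Finset (Fin N → F)} {z : Fin N → F} : z ∈ (merge A p t W L₁ L₂).val ↔
      z ∈ W ∧ ∃ x ∈ L₁, ∃ y ∈ L₂, Matches A p t (x + y) ∧ z = x + y := by
  simp only [merge, Finset.mem_filter]

theorem card_merge_le (A : Matrix (Fin N) (Fin l) F) (p : ℕ) (t : Fin l → F)
    (W L₁ L₂ : Finset (Fin N → F)) :
    ((merge A p t W L₁ L₂).val.card : ℝ) ≤ collisions p t L₁ L₂ A := by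
  classical
  have h1 : (merge A p t W L₁ L₂).val ⊆
      ((L₂ ×ˢ L₁).filter fun yx => Matches A p t (yx.2 + yx.1)).image fun yx => yx.2 + yx.1 := by
    intro z hz
    obtain ⟨-, x, hx, y, hy, h, rfl⟩ := mem_merge.1 hz
    exact Finset.mem_image.2 ⟨(y, x), Finset.mem_filter.2 ⟨Finset.mem_product.2 ⟨hy, hx⟩, h⟩, rfl⟩
  have h2 := (Finset.card_le_card h1).trans Finset.card_image_le
  have h3 : collisions p t L₁ L₂ A =
      (((L₂ ×ˢ L₁).filter fun yx => Matches A p t (yx.2 + yx.1)).card : ℝ) := by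
    rw [collisions, ← Finset.sum_product' L₂ L₁ fun y x => ind p t (x + y) A]
    simp only [ind, Finset.sum_boole]
  rw [h3]
  exact_mod_cast h2

theorem determinedBy_ind (p : ℕ) (t : Fin l → F) (x : Fin N → F) :
    DeterminedBy {x} (fun A => ind p t x A) := by
  have := (determinedBy_const (F := F) (N := N) (l := l) 1).mul_ind p t x
  simpa using this

open Classical in
/-- The list of level-1 vectors which the representation merge produces from the matching elements
of `D`. -/
noncomputable def levelOne (A : Matrix (Fin N) (Fin l) F) (u u' : ℕ) (t : Fin l → F)
    (D W : Finset (Fin N → F)) : Finset (Fin N → F) :=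
  (merge A u' t W (D.filter fun x => Matches A u t x) (D.filter fun x => Matches A u 0 x)).val

theorem mem_levelOne {A : Matrix (Fin N) (Fin l) F} {u u' : ℕ} {t : Fin l → F}
    {D W : Finset (Fin N → F)} {z : Fin N → F} : z ∈ levelOne A u u' t D W ↔
      z ∈ W ∧ ∃ x ∈ D, z - x ∈ D ∧ Matches A u t x ∧ Matches A (max u' u) t z := by
  classical
  simp only [levelOne, mem_merge, Finset.mem_filter]
  refine and_congr_right fun _ => ?_
  constructor
  · rintro ⟨x, ⟨hx, hxu⟩, y, ⟨hy, hyu⟩, hxy, rfl⟩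
    have := matches_pair_iff.1 ⟨hxu, hyu, hxy⟩
    exact ⟨x, hx, by rwa [add_sub_cancel_left], this⟩
  · rintro ⟨x, hx, hy, hxu, hz⟩
    have hz' : x + (z - x) = z := add_sub_cancel x z
    have := matches_pair_iff.2 ⟨hxu, hz'.symm ▸ hz⟩
    exact ⟨x, ⟨hx, hxu⟩, z - x, ⟨hy, this.2.1⟩, this.2.2, hz'.symm⟩

end Merge

variable [Fintype F]

/-- The expected number of matching elements of a list. -/
theorem expect_sum_ind_le (D : Finset (Fin N → F)) (p : ℕ) (t : Fin l → F) :
    expect (fun A => ∑ x ∈ D, ind p t x A) ≤ 1 + D.card * matchProb F l p := by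
  have := expect_mul_sum_ind_le (determinedBy_const (F := F) (N := N) (l := l) 1)
    (fun _ => zero_le_one) p t D (v := id) Function.injective_id.injOn (K := 0) (by simp)
  simpa [expect_const] using this

theorem le_expect_sum_ind (D : Finset (Fin N → F)) (p : ℕ) (t : Fin l → F) :
    (D.card - 1) * matchProb F l p ≤ expect (fun A => ∑ x ∈ D, ind p t x A) := by
  have := le_expect_mul_sum_ind (determinedBy_const (F := F) (N := N) (l := l) 1)
    (fun _ => zero_le_one) p t D (v := id) Function.injective_id.injOn (K := 0) (by simp)
  simpa [expect_const] using this

variable [DecidableEq F]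

/-- For each `x`, at most `q` of the sums `x + y` lie in the span of `x`; the others are independent
of the event that `x` matches. -/
theorem expect_pairs_le (D : Finset (Fin N → F)) (u p : ℕ) (t : Fin l → F) :
    expect (fun A => ∑ x ∈ D, ind u t x A * ∑ y ∈ D, ind p t (x + y) A) ≤
      (Fintype.card F + D.card * matchProb F l p) * (1 + D.card * matchProb F l u) := by
  rw [expect_sum]
  have hq : 0 ≤ Fintype.card F + D.card * matchProb F l p :=
    add_nonneg (by positivity) (mul_nonneg (by positivity) (matchProb_pos p).le)
  calc _ ≤ ∑ x ∈ D, (Fintype.card F + D.card * matchProb F l p) *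
        expect (fun A => ind u t x A) := by
        refine Finset.sum_le_sum fun x _ => ?_
        have := expect_mul_sum_ind_le (determinedBy_ind u t x) (fun A => ind_nonneg u t x A) p t D
          (injOn_const_add x _) (K := 1) (by simp)
        rwa [pow_one] at this
    _ ≤ _ := by
        rw [← Finset.mul_sum, ← expect_sum]
        exact mul_le_mul_of_nonneg_left (expect_sum_ind_le D u t) hq

theorem le_expect_pairs (D : Finset (Fin N → F)) (hD : (Fintype.card F : ℝ) ≤ D.card) (u p : ℕ)
    (t : Fin l → F) :
    ((D.card - Fintype.card F) * matchProb F l p) * ((D.card - 1) * matchProb F l u) ≤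
      expect (fun A => ∑ x ∈ D, ind u t x A * ∑ y ∈ D, ind p t (x + y) A) := by
  rw [expect_sum]
  have hq : 0 ≤ (D.card - Fintype.card F) * matchProb F l p :=
    mul_nonneg (by linarith) (matchProb_pos p).le
  calc _ ≤ ∑ x ∈ D, (D.card - Fintype.card F) * matchProb F l p *
        expect (fun A => ind u t x A) := by
        rw [← Finset.mul_sum, ← expect_sum]
        exact mul_le_mul_of_nonneg_left (le_expect_sum_ind D u t) hq
    _ ≤ _ := by
        refine Finset.sum_le_sum fun x _ => ?_
        have := le_expect_mul_sum_ind (determinedBy_ind u t x) (fun A => ind_nonneg u t x A) p t D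
          (injOn_const_add x _) (K := 1) (by simp)
        rwa [pow_one] at this

open Classical in
/-- The pairs of dependent vectors among the collisions of the last merge are at most `q` times as
many as there are elements in the first list. -/
theorem collisions_levelOne_le (A : Matrix (Fin N) (Fin l) F) (u u' p : ℕ) (t : Fin l → F)
    (D W : Finset (Fin N → F)) :
    collisions p t (levelOne A u u' t D W) (levelOne A u u' 0 D W) A ≤
      Fintype.card F * (levelOne A u u' t D W).card +
        ∑ x ∈ W, ind (max u' u) t x A *
          ∑ y ∈ W.filter (fun y => x + y ∉ Submodule.span F (({x} : Finset (Fin N → F)) :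
            Set (Fin N → F))), ind p t (x + y) A := by
  rw [collisions, Finset.sum_comm]
  have hsub : ∀ t', levelOne A u u' t' D W ⊆ W := fun t' z hz => (mem_levelOne.1 hz).1
  have h1 : ∀ x ∈ levelOne A u u' t D W, ∑ y ∈ levelOne A u u' 0 D W, ind p t (x + y) A ≤
      Fintype.card F + ind (max u' u) t x A *
          ∑ y ∈ W.filter (fun y => x + y ∉ Submodule.span F (({x} : Finset (Fin N → F)) :
            Set (Fin N → F))), ind p t (x + y) A := by
    intro x hx
    obtain ⟨-, -, -, -, -, hm⟩ := mem_levelOne.1 hx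
    rw [ind_of_matches hm, one_mul, ← Finset.sum_filter_add_sum_filter_not _ (fun y => x + y ∈
      Submodule.span F (({x} : Finset (Fin N → F)) : Set (Fin N → F)))]
    refine add_le_add ?_ ?_
    · refine (Finset.sum_le_card_nsmul _ _ 1 fun y _ => ?_).trans ?_
      · unfold ind
        split_ifs <;> norm_num
      · have := card_filter_mem_span_le {x} (levelOne A u u' 0 D W) (injOn_const_add x _)
          (K := 1) (by simp)
        rw [nsmul_eq_mul, mul_one]
        rwa [pow_one] at this
    · exact Finset.sum_le_sum_of_subset_of_nonneg (Finset.filter_subset_filter _ (hsub 0))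
        fun _ _ _ => ind_nonneg _ _ _ _
  refine (Finset.sum_le_sum h1).trans ?_
  rw [Finset.sum_add_distrib, Finset.sum_const, nsmul_eq_mul, mul_comm]
  refine add_le_add le_rfl ?_
  exact Finset.sum_le_sum_of_subset_of_nonneg (hsub t) fun _ _ _ =>
    mul_nonneg (ind_nonneg _ _ _ _) (Finset.sum_nonneg fun _ _ => ind_nonneg _ _ _ _)

open Classical in
/-- The expected number of colliding independent pairs in the last merge, where `x` matches on `u`
positions and `x + y` on `p` positions. -/
theorem expect_independent_pairs_le (W : Finset (Fin N → F)) (u p : ℕ) (t : Fin l → F) :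
    expect (fun A => ∑ x ∈ W, ind u t x A *
      ∑ y ∈ W.filter (fun y => x + y ∉ Submodule.span F (({x} : Finset (Fin N → F)) :
            Set (Fin N → F))), ind p t (x + y) A) ≤
      (W.card * matchProb F l p) * (1 + W.card * matchProb F l u) := by
  rw [expect_sum]
  have hp := (matchProb_pos (F := F) (l := l) p).le
  calc _ ≤ ∑ x ∈ W, (W.card * matchProb F l p) * expect (fun A => ind u t x A) := by
        refine Finset.sum_le_sum fun x _ => ?_
        have hE : 0 ≤ expect (fun A => ind u t x A) := expect_nonneg fun A => ind_nonneg u t x A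
        rw [expect_mul_sum_ind_eq,
          Finset.sum_congr rfl (g := fun _ => expect (fun A => ind u t x A) * matchProb F l p)
            fun y hy => expect_mul_ind (determinedBy_ind u t x) p t (Finset.mem_filter.1 hy).2,
          Finset.sum_const, nsmul_eq_mul]
        have : ((W.filter (fun y => x + y ∉ Submodule.span F (({x} : Finset (Fin N → F)) :
            Set (Fin N → F)))).card : ℝ) ≤ W.card := by exact_mod_cast Finset.card_filter_le _ _
        calc _ ≤ (W.card : ℝ) * (expect (fun A => ind u t x A) * matchProb F l p) :=
              mul_le_mul_of_nonneg_right this (mul_nonneg hE hp)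
          _ = _ := by ring
    _ ≤ _ := by
        rw [← Finset.mul_sum, ← expect_sum]
        exact mul_le_mul_of_nonneg_left (expect_sum_ind_le W u t) (mul_nonneg (by positivity) hp)

/-- The last merge has many collisions: by the second moment method, a pair of level-1 vectors that
could collide has matching representations, and is thus found, with a probability that is bounded
below in terms of the number `M` of available representations of each of its members. -/
theorem le_expect_collisions_levelOne {D W G : Finset (Fin N → F)} (hGW : G ⊆ W) (u u' : ℕ)
    (t : Fin l → F) {M : ℕ} (hM : (Fintype.card F : ℝ) ^ 6 ≤ M)
    (hG : (Fintype.card F : ℝ) ≤ G.card)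
    (hS : ∀ e ∈ G, ∃ S : Finset (Fin N → F), S.card = M ∧ ∀ x ∈ S, x ∈ D ∧ e - x ∈ D) :
    ((M - (Fintype.card F : ℝ) ^ 6) * matchProb F l u) ^ 4 /
        ((Fintype.card F : ℝ) ^ 6 + M * matchProb F l u) ^ 4 *
      (((G.card - Fintype.card F) * matchProb F l l) *
        ((G.card - 1) * matchProb F l (max u' u))) ≤
      expect (fun A => collisions l t (levelOne A u u' t D W) (levelOne A u u' 0 D W) A) := by
  classical
  choose! S hS1 hS2 using hS
  set p := max u' u with hp
  set f : (Fin N → F) → (Fin N → F) → Matrix (Fin N) (Fin l) F → ℝ := fun x y A =>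
    ind p t x A * ind l t (x + y) A with hf
  set I : (Fin N → F) → (Fin N → F) → Matrix (Fin N) (Fin l) F → ℝ := fun x y A =>
    if 0 < matchCount u (S x, t) A ∧ 0 < matchCount u (S y, (0 : Fin l → F)) A then 1 else 0
    with hI
  have hf0 : ∀ x y A, 0 ≤ f x y A := fun x y A =>
    mul_nonneg (ind_nonneg _ _ _ _) (ind_nonneg _ _ _ _)
  have hfind : ∀ A, ∀ x ∈ G, ∀ St : Fin l → F, 0 < matchCount u (S x, St) A →
      Matches A p St x → x ∈ levelOne A u u' St D W := by
    intro A x hx St hpos hm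
    obtain ⟨z, hz, hzpos⟩ : ∃ z ∈ S x, 0 < ind u St z A := by
      by_contra! h
      exact absurd hpos (not_lt.2 (Finset.sum_nonpos h))
    exact mem_levelOne.2 ⟨hGW hx, z, (hS2 x hx z hz).1, (hS2 x hx z hz).2,
      matches_of_ind_pos hzpos, hm⟩
  have hpt : ∀ A, ∑ x ∈ G, ∑ y ∈ G, f x y A * I x y A ≤
      collisions l t (levelOne A u u' t D W) (levelOne A u u' 0 D W) A := by
    intro A
    have hc : collisions l t (levelOne A u u' t D W) (levelOne A u u' 0 D W) A =
        ∑ xy ∈ levelOne A u u' t D W ×ˢ levelOne A u u' 0 D W, ind l t (xy.1 + xy.2) A := by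
      rw [collisions, Finset.sum_comm, Finset.sum_product]
    have hmem : ∀ xy ∈ G ×ˢ G, f xy.1 xy.2 A * I xy.1 xy.2 A ≠ 0 →
        xy ∈ levelOne A u u' t D W ×ˢ levelOne A u u' 0 D W := by
      rintro ⟨x, y⟩ hxy hne
      obtain ⟨hx, hy⟩ := Finset.mem_product.1 hxy
      have h1 : I x y A ≠ 0 := right_ne_zero_of_mul hne
      have h2 : f x y A ≠ 0 := left_ne_zero_of_mul hne
      have h3 : 0 < matchCount u (S x, t) A ∧ 0 < matchCount u (S y, (0 : Fin l → F)) A := by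
        by_contra h
        exact h1 (if_neg h)
      have h4 : Matches A p t x :=
        matches_of_ind_pos ((ind_nonneg _ _ _ _).lt_of_ne (left_ne_zero_of_mul h2).symm)
      have h5 : Matches A l t (x + y) :=
        matches_of_ind_pos ((ind_nonneg _ _ _ _).lt_of_ne (right_ne_zero_of_mul h2).symm)
      have h6 : Matches A p (0 : Fin l → F) y := by
        have h7 : Matches A p t (x + y) := fun j _ => h5 j j.2
        have h8 := h7.sub h4
        rwa [sub_self, add_sub_cancel_left] at h8
      exact Finset.mem_product.2 ⟨hfind A x hx t h3.1 h4, hfind A y hy 0 h3.2 h6⟩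
    have hle : ∀ x y, f x y A * I x y A ≤ ind l t (x + y) A := by
      intro x y
      have h1 : I x y A ≤ 1 := by simp only [hI]; split_ifs <;> norm_num
      have h2 : ind p t x A ≤ 1 := by unfold ind; split_ifs <;> norm_num
      exact (mul_le_of_le_one_right (hf0 x y A) h1).trans
        (mul_le_of_le_one_left (ind_nonneg _ _ _ _) h2)
    rw [hc, ← Finset.sum_product' G G fun x y => f x y A * I x y A,
      ← Finset.sum_filter_ne_zero]
    refine (Finset.sum_le_sum fun xy _ => hle xy.1 xy.2).trans ?_
    refine Finset.sum_le_sum_of_subset_of_nonneg (fun xy hxy => ?_) fun _ _ _ => ind_nonneg _ _ _ _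
    obtain ⟨h1, h2⟩ := Finset.mem_filter.1 hxy
    exact hmem xy h1 h2
  refine le_trans ?_ (expect_mono hpt)
  set c := ((M - (Fintype.card F : ℝ) ^ 6) * matchProb F l u) ^ 4 /
        ((Fintype.card F : ℝ) ^ 6 + M * matchProb F l u) ^ 4 with hc
  have hc0 : 0 ≤ c := by
    have := (matchProb_pos (F := F) (l := l) u).le
    positivity
  calc _ ≤ c * expect (fun A => ∑ x ∈ G, ind p t x A * ∑ y ∈ G, ind l t (x + y) A) :=
        mul_le_mul_of_nonneg_left (le_expect_pairs G hG p l t) hc0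
    _ = ∑ x ∈ G, ∑ y ∈ G, c * expect (f x y) := by
        simp only [Finset.mul_sum, expect_sum, hf]
    _ ≤ ∑ x ∈ G, ∑ y ∈ G, expect (fun A => f x y A * I x y A) := by
        refine Finset.sum_le_sum fun x hx => Finset.sum_le_sum fun y hy => ?_
        refine expect_both_match_ge u hM (Z := insert (x + y) {x}) ?_
          ((determinedBy_ind p t x).mul_ind l t (x + y)) (hf0 x y) (fun A => ?_)
          (St := (S x, t)) (St' := (S y, 0)) (hS1 x hx) (hS1 y hy)
        · have := Finset.card_insert_le (x + y) ({x} : Finset (Fin N → F))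
          rw [Finset.card_singleton] at this
          omega
        · rw [mul_mul_mul_comm, ind_mul_self, ind_mul_self]
    _ = _ := by
        rw [expect_sum]
        exact Finset.sum_congr rfl fun x _ => (expect_sum G fun y A => f x y A * I x y A).symm

end Cost

section Pairs

variable {F : Type w} [Field F] {N l : ℕ}

/-- The number of colliding pairs in the representation merges, for the list `D` of candidates. -/
noncomputable def pairCount (D : Finset (Fin N → F)) (u p : ℕ) (t : Fin l → F)
    (A : Matrix (Fin N) (Fin l) F) : ℝ :=
  ∑ x ∈ D, ind u t x A * ∑ y ∈ D, ind p t (x + y) A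

theorem pairCount_nonneg (D : Finset (Fin N → F)) (u p : ℕ) (t : Fin l → F)
    (A : Matrix (Fin N) (Fin l) F) : 0 ≤ pairCount D u p t A :=
  Finset.sum_nonneg fun _ _ => mul_nonneg (ind_nonneg _ _ _ _)
    (Finset.sum_nonneg fun _ _ => ind_nonneg _ _ _ _)

theorem card_filter_matches (D : Finset (Fin N → F)) (u : ℕ) (t : Fin l → F)
    (A : Matrix (Fin N) (Fin l) F) [DecidablePred fun x => Matches A u t x] :
    ((D.filter fun x => Matches A u t x).card : ℝ) = ∑ x ∈ D, ind u t x A := by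
  rw [Finset.card_filter, Nat.cast_sum]
  refine Finset.sum_congr rfl fun x _ => ?_
  unfold ind
  split_ifs <;> simp

theorem card_levelOne_le [DecidableEq F] (A : Matrix (Fin N) (Fin l) F) (u u' : ℕ) (t : Fin l → F)
    (D W : Finset (Fin N → F)) :
    ((levelOne A u u' t D W).card : ℝ) ≤ pairCount D u (max u' u) t A := by
  rw [pairCount, ← collisions_filter]
  exact card_merge_le A u' t W _ _

end Pairs

section Algorithm

variable {F : Type w} [Field F] [Fintype F] [DecidableEq F] {g : F}

open Classical in
theorem merge_base {N l w v : ℕ} (hv : w + w = v) (A : Matrix (Fin N) (Fin l) F) (u : ℕ)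
    (t : Fin l → F) :
    (merge A u t (wellFormed g N v) (baseLeft g N w) (baseRight g N w)).val =
      (balanced g N w w).filter fun x => Matches A u t x := by
  ext z
  rw [mem_merge, Finset.mem_filter, mem_balanced_iff]
  constructor
  · rintro ⟨-, x, hx, y, hy, h, rfl⟩
    exact ⟨⟨x, hx, y, hy, rfl⟩, h⟩
  · rintro ⟨⟨x, hx, y, hy, rfl⟩, h⟩
    exact ⟨balanced_subset hv (mem_balanced_iff.2 ⟨x, hx, y, hy, rfl⟩), x, hx, y, hy, h, rfl⟩

theorem collisions_base {N l : ℕ} (w u : ℕ) (t : Fin l → F) (A : Matrix (Fin N) (Fin l) F) :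
    collisions u t (baseLeft g N w) (baseRight g N w) A =
      ∑ x ∈ balanced g N w w, ind u t x A :=
  sum_baseLeft_baseRight (fun z => ind u t z A) w

/-- The number of steps of the algorithm, in terms of the numbers of colliding pairs. -/
theorem bjmmPlus_steps (P : Params) (hv : Even (P.v 2)) (A : Matrix (Fin P.N) (Fin P.l) F)
    (s : Fin P.l → F) : ((bjmmPlus g P A s).steps : ℝ) =
      5 * ((baseLeft g P.N (P.v 2 / 2)).card + (baseRight g P.N (P.v 2 / 2)).card) +
      2 * ∑ x ∈ balanced g P.N (P.v 2 / 2) (P.v 2 / 2), ind (P.u g 1) s x A +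
      6 * ∑ x ∈ balanced g P.N (P.v 2 / 2) (P.v 2 / 2), ind (P.u g 1) 0 x A +
      pairCount (balanced g P.N (P.v 2 / 2) (P.v 2 / 2)) (P.u g 1) (max (P.u g 0) (P.u g 1)) s A +
      pairCount (balanced g P.N (P.v 2 / 2) (P.v 2 / 2)) (P.u g 1) (max (P.u g 0) (P.u g 1)) 0 A +
      (levelOne A (P.u g 1) (P.u g 0) s (balanced g P.N (P.v 2 / 2) (P.v 2 / 2))
        (wellFormed g P.N (P.v 1))).card +
      (levelOne A (P.u g 1) (P.u g 0) 0 (balanced g P.N (P.v 2 / 2) (P.v 2 / 2))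
        (wellFormed g P.N (P.v 1))).card +
      collisions P.l s
        (levelOne A (P.u g 1) (P.u g 0) s (balanced g P.N (P.v 2 / 2) (P.v 2 / 2))
          (wellFormed g P.N (P.v 1)))
        (levelOne A (P.u g 1) (P.u g 0) 0 (balanced g P.N (P.v 2 / 2) (P.v 2 / 2))
          (wellFormed g P.N (P.v 1))) A := by
  classical
  obtain ⟨m, hm⟩ := hv
  have hw : P.v 2 / 2 + P.v 2 / 2 = P.v 2 := by omega
  set B₁ := baseLeft g P.N (P.v 2 / 2)
  set B₂ := baseRight g P.N (P.v 2 / 2)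
  set Y : (Fin P.l → F) → Timed (Finset (Fin P.N → F)) := fun t =>
    merge A (P.u g 1) t (wellFormed g P.N (P.v 2)) B₁ B₂ with hY
  set X : (Fin P.l → F) → Timed (Finset (Fin P.N → F)) := fun t =>
    merge A (P.u g 0) t (wellFormed g P.N (P.v 1)) (Y t).val (Y 0).val with hX
  have hsteps : (bjmmPlus g P A s).steps = B₁.card + (B₂.card + ((Y s).steps + ((Y 0).steps +
      ((Y 0).steps + ((Y 0).steps + ((X s).steps + ((X 0).steps +
        (merge A P.l s (wellFormed g P.N (P.v 0)) (X s).val (X 0).val).steps))))))) := rfl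
  have hYv : ∀ t, (Y t).val = (balanced g P.N (P.v 2 / 2) (P.v 2 / 2)).filter
      fun x => Matches A (P.u g 1) t x := fun t => merge_base hw A _ t
  have hYs : ∀ t, ((Y t).steps : ℝ) = B₁.card + B₂.card +
      ∑ x ∈ balanced g P.N (P.v 2 / 2) (P.v 2 / 2), ind (P.u g 1) t x A := fun t => by
    rw [← collisions_base]
    exact merge_steps _ _ _ _ _ _
  have hXs : ∀ t, ((X t).steps : ℝ) =
      ∑ x ∈ balanced g P.N (P.v 2 / 2) (P.v 2 / 2), ind (P.u g 1) t x A +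
      ∑ x ∈ balanced g P.N (P.v 2 / 2) (P.v 2 / 2), ind (P.u g 1) 0 x A +
      pairCount (balanced g P.N (P.v 2 / 2) (P.v 2 / 2)) (P.u g 1)
        (max (P.u g 0) (P.u g 1)) t A := fun t => by
    simp only [hX]
    rw [merge_steps, hYv, hYv, card_filter_matches, card_filter_matches, collisions_filter]
    rfl
  have hXv : ∀ t, (X t).val = levelOne A (P.u g 1) (P.u g 0) t
      (balanced g P.N (P.v 2 / 2) (P.v 2 / 2)) (wellFormed g P.N (P.v 1)) := fun t => by
    simp only [hX, hYv]
    rw [levelOne]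
  have hlast := merge_steps A P.l s (wellFormed g P.N (P.v 0)) (X s).val (X 0).val
  rw [hsteps]
  push_cast
  rw [hlast, hYs s, hYs 0, hXs s, hXs 0, hXv s, hXv 0]
  ring

theorem card_balanced_eq_sq (P : Params) (hP : P.Admissible) (hg : orderOf g = 6)
    (h7 : (7 : F) ≠ 0) :
    ((balanced g P.N (P.v 2 / 2) (P.v 2 / 2)).card : ℝ) =
    ((baseLeft g P.N (P.v 2 / 2)).card : ℝ) ^ 2 := by
  rw [card_balanced hg h7 hP.even_length, card_baseLeft hg h7, sq]
  push_cast
  rfl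

theorem card_baseRight_eq (P : Params) (hP : P.Admissible) (hg : orderOf g = 6)
    (h7 : (7 : F) ≠ 0) :
    (baseRight g P.N (P.v 2 / 2)).card =
    (baseLeft g P.N (P.v 2 / 2)).card := by
  rw [card_baseRight hg h7 hP.even_length, card_baseLeft hg h7]

/-- The enumeration cost, from above. -/
theorem enumerationCost_le (P : Params) (hP : P.Admissible) (hg : orderOf g = 6)
    (h7 : (7 : F) ≠ 0) (s : Fin P.l → F) :
    enumerationCost g P s ≤ 10 * ((baseLeft g P.N (P.v 2 / 2)).card : ℝ) +
      8 * (1 + ((baseLeft g P.N (P.v 2 / 2)).card : ℝ) ^ 2 * matchProb F P.l (P.u g 1)) +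
      (4 + Fintype.card F) * ((Fintype.card F + ((baseLeft g P.N (P.v 2 / 2)).card : ℝ) ^ 2 *
          matchProb F P.l (max (P.u g 0) (P.u g 1))) *
        (1 + ((baseLeft g P.N (P.v 2 / 2)).card : ℝ) ^ 2 * matchProb F P.l (P.u g 1))) +
      (((wellFormed g P.N (P.v 1)).card : ℝ) * matchProb F P.l P.l) *
        (1 + ((wellFormed g P.N (P.v 1)).card : ℝ) *
          matchProb F P.l (max (P.u g 0) (P.u g 1))) := by
  classical
  set D := balanced g P.N (P.v 2 / 2) (P.v 2 / 2) with hD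
  set W := wellFormed g P.N (P.v 1) with hW
  set p := max (P.u g 0) (P.u g 1) with hp
  have hDc : (D.card : ℝ) = ((baseLeft g P.N (P.v 2 / 2)).card : ℝ) ^ 2 :=
    card_balanced_eq_sq P hP hg h7
  rw [← hDc]
  have hpt : ∀ A, ((bjmmPlus g P A s).steps : ℝ) ≤ 10 * ((baseLeft g P.N (P.v 2 / 2)).card : ℝ) +
      2 * ∑ x ∈ D, ind (P.u g 1) s x A + 6 * ∑ x ∈ D, ind (P.u g 1) 0 x A +
      (2 + Fintype.card F) * pairCount D (P.u g 1) p s A + 2 * pairCount D (P.u g 1) p 0 A +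
        ∑ x ∈ W, ind p s x A *
          ∑ y ∈ W.filter (fun y => x + y ∉ Submodule.span F (({x} : Finset (Fin P.N → F)) :
            Set (Fin P.N → F))), ind P.l s (x + y) A := by
    intro A
    rw [bjmmPlus_steps P (hP.even_weight 2 le_rfl), card_baseRight_eq P hP hg h7]
    have h1 := card_levelOne_le A (P.u g 1) (P.u g 0) s D W
    have h2 := card_levelOne_le A (P.u g 1) (P.u g 0) 0 D W
    have h3 := collisions_levelOne_le A (P.u g 1) (P.u g 0) P.l s D W
    have h4 := mul_le_mul_of_nonneg_left h1 (Nat.cast_nonneg (α := ℝ) (Fintype.card F))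
    linarith
  have hsum := fun t => expect_sum_ind_le (l := P.l) D (P.u g 1) t
  have hpair := fun t => expect_pairs_le (l := P.l) D (P.u g 1) p t
  have hlast := expect_independent_pairs_le W p P.l s
  have hE : enumerationCost g P s = expect fun A => ((bjmmPlus g P A s).steps : ℝ) := rfl
  rw [hE]
  refine (expect_mono hpt).trans ?_
  simp only [expect_add, expect_const_mul, expect_const]
  have h1 := hsum s
  have h2 := hsum 0
  have h3 : expect (fun A => pairCount D (P.u g 1) p s A) ≤ _ := hpair s
  have h4 : expect (fun A => pairCount D (P.u g 1) p 0 A) ≤ _ := hpair 0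
  have h5 := mul_le_mul_of_nonneg_left h3 (Nat.cast_nonneg (α := ℝ) (Fintype.card F))
  linarith

/-- The number of colliding pairs in the last merge. -/
noncomputable def lastCollisions (g : F) (P : Params) (A : Matrix (Fin P.N) (Fin P.l) F)
    (s : Fin P.l → F) : ℝ :=
  collisions P.l s
    (levelOne A (P.u g 1) (P.u g 0) s (balanced g P.N (P.v 2 / 2) (P.v 2 / 2))
      (wellFormed g P.N (P.v 1)))
    (levelOne A (P.u g 1) (P.u g 0) 0 (balanced g P.N (P.v 2 / 2) (P.v 2 / 2))
      (wellFormed g P.N (P.v 1))) A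

theorem lastCollisions_nonneg (P : Params) (A : Matrix (Fin P.N) (Fin P.l) F)
    (s : Fin P.l → F) : 0 ≤ lastCollisions g P A s := collisions_nonneg _ _ _ _ _

/-- The contributions to the cost that determine its exponent. -/
theorem steps_ge (P : Params) (hP : P.Admissible) (A : Matrix (Fin P.N) (Fin P.l) F)
    (s : Fin P.l → F) : ((baseLeft g P.N (P.v 2 / 2)).card : ℝ) +
      ∑ x ∈ balanced g P.N (P.v 2 / 2) (P.v 2 / 2), ind (P.u g 1) s x A +
      pairCount (balanced g P.N (P.v 2 / 2) (P.v 2 / 2)) (P.u g 1) (max (P.u g 0) (P.u g 1)) s A +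
      lastCollisions g P A s ≤ ((bjmmPlus g P A s).steps : ℝ) := by
  rw [bjmmPlus_steps P (hP.even_weight 2 le_rfl), lastCollisions]
  have h0 := fun t => Finset.sum_nonneg fun x (_ : x ∈ balanced g P.N (P.v 2 / 2) (P.v 2 / 2)) =>
    ind_nonneg (P.u g 1) t x A
  have h1 := h0 s
  have h2 := h0 0
  have h4 := pairCount_nonneg (balanced g P.N (P.v 2 / 2) (P.v 2 / 2)) (P.u g 1)
    (max (P.u g 0) (P.u g 1)) 0 A
  have h5 := Nat.cast_nonneg (α := ℝ) (baseLeft g P.N (P.v 2 / 2)).card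
  have h6 := Nat.cast_nonneg (α := ℝ) (baseRight g P.N (P.v 2 / 2)).card
  linarith [Nat.cast_nonneg (α := ℝ) (levelOne A (P.u g 1) (P.u g 0) s
    (balanced g P.N (P.v 2 / 2) (P.v 2 / 2)) (wellFormed g P.N (P.v 1))).card,
    Nat.cast_nonneg (α := ℝ) (levelOne A (P.u g 1) (P.u g 0) 0
    (balanced g P.N (P.v 2 / 2) (P.v 2 / 2)) (wellFormed g P.N (P.v 1))).card]

/-- The cost of enumerating the base lists. -/
theorem card_baseLeft_le_enumerationCost (P : Params) (hP : P.Admissible) (s : Fin P.l → F) :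
    ((baseLeft g P.N (P.v 2 / 2)).card : ℝ) ≤ enumerationCost g P s := by
  rw [← expect_const (F := F) (N := P.N) (l := P.l) ((baseLeft g P.N (P.v 2 / 2)).card : ℝ)]
  refine expect_mono fun A => ?_
  have h1 := steps_ge (g := g) P hP A s
  have h2 : 0 ≤ ∑ x ∈ balanced g P.N (P.v 2 / 2) (P.v 2 / 2), ind (P.u g 1) s x A :=
    Finset.sum_nonneg fun x _ => ind_nonneg _ _ _ _
  have h3 := pairCount_nonneg (balanced g P.N (P.v 2 / 2) (P.v 2 / 2))
    (P.u g 1) (max (P.u g 0) (P.u g 1)) s A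
  linarith [lastCollisions_nonneg (g := g) P A s]

/-- The cost of the first concatenation merge. -/
theorem concatenation_le_enumerationCost (P : Params) (hP : P.Admissible) (hg : orderOf g = 6)
    (h7 : (7 : F) ≠ 0) (s : Fin P.l → F) :
    (((baseLeft g P.N (P.v 2 / 2)).card : ℝ) ^ 2 - 1) * matchProb F P.l (P.u g 1) ≤
      enumerationCost g P s := by
  rw [← card_balanced_eq_sq P hP hg h7]
  refine (le_expect_sum_ind _ _ s).trans (expect_mono fun A => ?_)
  linarith [steps_ge (g := g) P hP A s, pairCount_nonneg (balanced g P.N (P.v 2 / 2) (P.v 2 / 2))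
    (P.u g 1) (max (P.u g 0) (P.u g 1)) s A, lastCollisions_nonneg (g := g) P A s,
    Nat.cast_nonneg (α := ℝ) (baseLeft g P.N (P.v 2 / 2)).card]

/-- The cost of the first representation merge. -/
theorem representation_le_enumerationCost (P : Params) (hP : P.Admissible) (hg : orderOf g = 6)
    (h7 : (7 : F) ≠ 0) (s : Fin P.l → F)
    (hq : (Fintype.card F : ℝ) ≤ ((baseLeft g P.N (P.v 2 / 2)).card : ℝ) ^ 2) :
    ((((baseLeft g P.N (P.v 2 / 2)).card : ℝ) ^ 2 - Fintype.card F) *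
        matchProb F P.l (max (P.u g 0) (P.u g 1))) *
      ((((baseLeft g P.N (P.v 2 / 2)).card : ℝ) ^ 2 - 1) * matchProb F P.l (P.u g 1)) ≤
      enumerationCost g P s := by
  rw [← card_balanced_eq_sq P hP hg h7] at hq ⊢
  refine (le_expect_pairs _ hq _ _ s).trans (expect_mono fun A => ?_)
  have h1 := steps_ge (g := g) P hP A s
  have h2 : 0 ≤ ∑ x ∈ balanced g P.N (P.v 2 / 2) (P.v 2 / 2), ind (P.u g 1) s x A :=
    Finset.sum_nonneg fun x _ => ind_nonneg _ _ _ _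
  have h3 := lastCollisions_nonneg (g := g) P A s
  have h4 := Nat.cast_nonneg (α := ℝ) (baseLeft g P.N (P.v 2 / 2)).card
  unfold pairCount at h1
  linarith

/-- The cost of the last merge. -/
theorem lastMerge_le_enumerationCost (P : Params) (hP : P.Admissible) (s : Fin P.l → F)
    {G : Finset (Fin P.N → F)} (hGW : G ⊆ wellFormed g P.N (P.v 1)) {M : ℕ}
    (hM : (Fintype.card F : ℝ) ^ 6 ≤ M) (hG : (Fintype.card F : ℝ) ≤ G.card)
    (hS : ∀ e ∈ G, ∃ S : Finset (Fin P.N → F), S.card = M ∧ ∀ x ∈ S,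
      x ∈ balanced g P.N (P.v 2 / 2) (P.v 2 / 2) ∧
      e - x ∈ balanced g P.N (P.v 2 / 2) (P.v 2 / 2)) :
    ((M - (Fintype.card F : ℝ) ^ 6) * matchProb F P.l (P.u g 1)) ^ 4 /
        ((Fintype.card F : ℝ) ^ 6 + M * matchProb F P.l (P.u g 1)) ^ 4 *
      (((G.card - Fintype.card F) * matchProb F P.l P.l) *
        ((G.card - 1) * matchProb F P.l (max (P.u g 0) (P.u g 1)))) ≤ enumerationCost g P s := by
  refine (le_expect_collisions_levelOne hGW (P.u g 1) (P.u g 0) s hM hG hS).trans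
    (expect_mono fun A => ?_)
  have h1 := steps_ge (g := g) P hP A s
  have h2 : 0 ≤ ∑ x ∈ balanced g P.N (P.v 2 / 2) (P.v 2 / 2), ind (P.u g 1) s x A :=
    Finset.sum_nonneg fun x _ => ind_nonneg _ _ _ _
  have h3 := pairCount_nonneg (balanced g P.N (P.v 2 / 2) (P.v 2 / 2))
    (P.u g 1) (max (P.u g 0) (P.u g 1)) s A
  have h4 := Nat.cast_nonneg (α := ℝ) (baseLeft g P.N (P.v 2 / 2)).card
  unfold lastCollisions at h1
  linarith

end Algorithm

/-! ### Parameters -/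

section Parameters

theorem Params.Admissible.v_le {P : Params} (hP : P.Admissible) : ∀ i ≤ 2, P.v i ≤ P.N
  | 0, _ => hP.weight_le
  | i + 1, h => by
    have h1 := hP.overlap_le i (by omega)
    have h2 := hP.cancel_le i (by omega)
    simp only [Params.v]
    omega

variable {F : Type w} [Field F] [Fintype F] [DecidableEq F] {g : F}

theorem wellFormed_eq (g : F) (N w : ℕ) : wellFormed g N w = wellFormedOn g (Fin N) w := by
  unfold wellFormed wellFormedOn
  congr

theorem card_wellFormed (hg : orderOf g = 6) (h7 : (7 : F) ≠ 0) (N w : ℕ) :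
    (wellFormed g N w).card = N.choose w * 6 ^ w := by
  rw [wellFormed_eq, card_wellFormedOn hg h7, Fintype.card_fin]

theorem Params.card_representations (P : Params) (hP : P.Admissible) (hg : orderOf g = 6)
    (h7 : (7 : F) ≠ 0) {i : ℕ} (hi : i < 2) {e : Fin P.N → F} (he : e ∈ wellFormed g P.N (P.v i)) :
    (representations g (P.v (i + 1)) (P.ε (i + 1)) (P.b (i + 1)) e).card =
      trinomial (P.v i) (2 * P.b (i + 1)) (P.v i / 2 - P.b (i + 1)) * 2 ^ (2 * P.b (i + 1)) *
        ((P.N - P.v i).choose (P.ε (i + 1)) * 6 ^ P.ε (i + 1)) :=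
  RSDP.card_representations hg h7 (hP.even_weight i hi.le) (hP.overlap_le i hi) rfl he

theorem Params.r_eq (P : Params) (hP : P.Admissible) (hg : orderOf g = 6)
    (h7 : (7 : F) ≠ 0) {i : ℕ} (hi : i < 2) : P.r g i =
      trinomial (P.v i) (2 * P.b (i + 1)) (P.v i / 2 - P.b (i + 1)) * 2 ^ (2 * P.b (i + 1)) *
        ((P.N - P.v i).choose (P.ε (i + 1)) * 6 ^ P.ε (i + 1)) := by
  have hne : (wellFormed g P.N (P.v i)).Nonempty := by
    rw [← Finset.card_pos, card_wellFormed hg h7]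
    exact Nat.mul_pos (Nat.choose_pos (hP.v_le i hi.le)) (by positivity)
  rw [Params.r, Finset.sup_congr rfl fun e he => P.card_representations hP hg h7 hi he,
    Finset.sup_const hne]

end Parameters

/-! ### Exponents of the quantities in the analysis -/

section Asymptotics

theorem two_mul_eta_half (x : ℝ) : 2 * eta (x / 2) = eta x + x := by
  rw [eta_div two_pos, Real.logb_self_eq_one one_lt_two, mul_one]

variable {x y : ℕ → ℕ} {α β : ℝ}

theorem tendsto_nat_add (hx : Tendsto (fun n => (x n : ℝ) / n) atTop (𝓝 α))
    (hy : Tendsto (fun n => (y n : ℝ) / n) atTop (𝓝 β)) :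
    Tendsto (fun n => ((x n + y n : ℕ) : ℝ) / n) atTop (𝓝 (α + β)) :=
  (hx.add hy).congr fun n => by rw [Nat.cast_add, add_div]

theorem tendsto_nat_sub (h : ∀ n, y n ≤ x n) (hx : Tendsto (fun n => (x n : ℝ) / n) atTop (𝓝 α))
    (hy : Tendsto (fun n => (y n : ℝ) / n) atTop (𝓝 β)) :
    Tendsto (fun n => ((x n - y n : ℕ) : ℝ) / n) atTop (𝓝 (α - β)) :=
  (hx.sub hy).congr fun n => by rw [Nat.cast_sub (h n), sub_div]

theorem tendsto_nat_two_mul (hx : Tendsto (fun n => (x n : ℝ) / n) atTop (𝓝 α)) :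
    Tendsto (fun n => ((2 * x n : ℕ) : ℝ) / n) atTop (𝓝 (2 * α)) :=
  (hx.const_mul 2).congr fun n => by rw [Nat.cast_mul, Nat.cast_ofNat, mul_div_assoc]

theorem tendsto_nat_half (hx : Tendsto (fun n => (x n : ℝ) / n) atTop (𝓝 α)) :
    Tendsto (fun n => ((x n / 2 : ℕ) : ℝ) / n) atTop (𝓝 (α / 2)) := by
  have h0 : Tendsto (fun n : ℕ => (1 : ℝ) / n) atTop (𝓝 0) := tendsto_const_div_atTop_nhds_zero_nat 1
  have h1 := (hx.div_const 2).sub h0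
  rw [sub_zero] at h1
  refine tendsto_of_tendsto_of_tendsto_of_le_of_le h1 (hx.div_const 2) (fun n => ?_) fun n => ?_
  · have : ((x n : ℕ) : ℝ) ≤ 2 * ((x n / 2 : ℕ) : ℝ) + 1 := by
      exact_mod_cast (by omega : x n ≤ 2 * (x n / 2) + 1)
    change (x n : ℝ) / n / 2 - 1 / n ≤ _
    rw [div_right_comm, ← sub_div]
    exact div_le_div_of_nonneg_right (by linarith) n.cast_nonneg
  · have : 2 * ((x n / 2 : ℕ) : ℝ) ≤ ((x n : ℕ) : ℝ) := by
      exact_mod_cast (by omega : 2 * (x n / 2) ≤ x n)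
    change _ ≤ (x n : ℝ) / n / 2
    rw [div_right_comm]
    exact div_le_div_of_nonneg_right (by linarith) n.cast_nonneg

theorem tendsto_nat_nonneg (hx : Tendsto (fun n => (x n : ℝ) / n) atTop (𝓝 α)) : 0 ≤ α :=
  ge_of_tendsto' hx fun _ => by positivity

theorem tendsto_nat_le (h : ∀ n, y n ≤ x n) (hx : Tendsto (fun n => (x n : ℝ) / n) atTop (𝓝 α))
    (hy : Tendsto (fun n => (y n : ℝ) / n) atTop (𝓝 β)) : β ≤ α :=
  le_of_tendsto_of_tendsto' hy hx fun n =>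
    div_le_div_of_nonneg_right (by exact_mod_cast h n) n.cast_nonneg

/-- The exponent of the number of vectors of given weight over the error set and zero. -/
theorem hasExponent_choose_mul_pow (h : ∀ n, y n ≤ x n)
    (hx : Tendsto (fun n => (x n : ℝ) / n) atTop (𝓝 α))
    (hy : Tendsto (fun n => (y n : ℝ) / n) atTop (𝓝 β)) :
    HasExponent (fun n => (((x n).choose (y n) * 6 ^ y n : ℕ) : ℝ))
      (eta β + eta (α - β) - eta α + Real.logb 2 6 * β) := by
  refine ((hasExponent_choose h hx hy).mul (HasExponent.const_pow (K := 6) (by norm_num) hy)).congr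
    (Eventually.of_forall fun n => ?_)
  push_cast
  rfl

/-- The exponent of the number of splittings of one half of a vector. -/
theorem hasExponent_splitCount {H a o c : ℕ → ℕ} {η α ω κ : ℝ} (h1 : ∀ n, 2 * a n + o n ≤ H n)
    (h2 : ∀ n, 2 * a n + o n + c n ≤ H n)
    (hH : Tendsto (fun n => (H n : ℝ) / n) atTop (𝓝 η))
    (ha : Tendsto (fun n => (a n : ℝ) / n) atTop (𝓝 α))
    (ho : Tendsto (fun n => (o n : ℝ) / n) atTop (𝓝 ω))
    (hc : Tendsto (fun n => (c n : ℝ) / n) atTop (𝓝 κ)) :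
    HasExponent (fun n => (splitCount (H n) (a n) (o n) (c n) : ℝ))
      (2 * eta α + eta ω - eta (2 * α + ω) + ω +
        (eta κ + eta (η - (2 * α + ω) - κ) - eta (η - (2 * α + ω)) + Real.logb 2 6 * κ)) := by
  have hv := tendsto_nat_add (tendsto_nat_two_mul ha) ho
  have hao := tendsto_nat_add ha ho
  have e1 := hasExponent_choose (fun n => by omega) hv hao
  have e2 := hasExponent_choose (fun n => by omega) hao ho
  have e3 := HasExponent.const_pow (K := 2) two_pos ho
  have e4 := hasExponent_choose_mul_pow (fun n => by have := h2 n; omega)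
    (tendsto_nat_sub h1 hH hv) hc
  have e := ((e1.mul e2).mul e3).mul e4
  have s1 : 2 * α + ω - (α + ω) = α := by ring
  have s2 : α + ω - ω = α := by ring
  rw [s1, s2, Real.logb_self_eq_one one_lt_two] at e
  convert e using 1
  · ext n
    rw [splitCount]
    push_cast
    ring
  · ring

theorem two_pow_le_choose {a n : ℕ} (h : 2 * a ≤ n) : 2 ^ a ≤ n.choose a := by
  refine le_trans ?_ (Nat.choose_le_choose a h)
  rw [← Nat.centralBinom_eq_two_mul_choose]
  clear h
  induction a with
  | zero => simp
  | succ a ih =>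
    have h1 := Nat.succ_mul_centralBinom_succ a
    have h2 : 0 < Nat.centralBinom a := Nat.centralBinom_pos a
    have h3 : (a + 1) * 2 ^ (a + 1) ≤ (a + 1) * Nat.centralBinom (a + 1) := by
      rw [h1, pow_succ]
      nlinarith
    exact Nat.le_of_mul_le_mul_left h3 (Nat.succ_pos a)

/-- The exponent of the probability of matching on a given number of positions. -/
theorem hasExponent_matchProb {F : Type w} [Fintype F] [Nonempty F] {p l : ℕ → ℕ} {X Y : ℝ}
    (hp : Tendsto (fun n => Real.logb 2 (Fintype.card F) * ((p n : ℝ) / n)) atTop (𝓝 X))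
    (hl : Tendsto (fun n => Real.logb 2 (Fintype.card F) * ((l n : ℝ) / n)) atTop (𝓝 Y)) :
    HasExponent (fun n => matchProb F (l n) (p n)) (-min X Y) := by
  refine ⟨Eventually.of_forall fun n => matchProb_pos _, ((hp.min hl).neg).congr fun n => ?_⟩
  have hq : 0 ≤ Real.logb 2 (Fintype.card F) :=
    Real.logb_nonneg one_lt_two (by exact_mod_cast Fintype.card_pos)
  simp only [matchProb]
  rw [Real.logb_inv, Real.logb_pow, ← mul_min_of_nonneg _ _ hq,
    min_div_div_right n.cast_nonneg, ← Nat.cast_min]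
  ring

/-- Rounding down to a power of `q` does not change exponents. -/
theorem tendsto_log_of_hasExponent {q : ℕ} (hq : 1 < q) {r : ℕ → ℕ} {U : ℝ}
    (hr : HasExponent (fun n => (r n : ℝ)) U) :
    Tendsto (fun n => Real.logb 2 q * ((Nat.log q (r n) : ℝ) / n)) atTop (𝓝 U) := by
  have hc : Tendsto (fun n : ℕ => Real.logb 2 q / (n : ℝ)) atTop (𝓝 0) :=
    tendsto_const_div_atTop_nhds_zero_nat _
  have h1 := hr.2.sub hc
  rw [sub_zero] at h1
  have hq0 : (0 : ℝ) < q := by exact_mod_cast (by omega : 0 < q)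
  refine tendsto_of_tendsto_of_tendsto_of_le_of_le' h1 hr.2 ?_ ?_
  · filter_upwards [hr.1] with n hn
    have h2 : ((r n : ℕ) : ℝ) ≤ (q : ℝ) ^ (Nat.log q (r n) + 1) := by
      exact_mod_cast (Nat.lt_pow_succ_log_self hq (r n)).le
    have h3 := Real.logb_le_logb_of_le one_lt_two hn h2
    rw [Real.logb_pow] at h3
    push_cast at h3
    rw [← sub_div, ← mul_div_assoc]
    exact div_le_div_of_nonneg_right (by linarith) n.cast_nonneg
  · filter_upwards [hr.1] with n hn
    have h2 : (q : ℝ) ^ Nat.log q (r n) ≤ ((r n : ℕ) : ℝ) := by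
      exact_mod_cast Nat.pow_log_le_self q (by exact_mod_cast hn.ne' : r n ≠ 0)
    have h3 := Real.logb_le_logb_of_le one_lt_two (by positivity) h2
    rw [Real.logb_pow] at h3
    rw [← mul_div_assoc]
    exact div_le_div_of_nonneg_right (by linarith) n.cast_nonneg

end Asymptotics

section Sequences

variable {F : Type w} [Field F] [Fintype F] [DecidableEq F] {g : F}

theorem tendsto_v {P : ℕ → Params} (hP : ∀ n, (P n).Admissible) {V E B : ℕ → ℝ}
    (hV₀ : Tendsto (fun n => ((P n).v₀ : ℝ) / n) atTop (𝓝 (V 0)))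
    (hE : ∀ i < 2, Tendsto (fun n => ((P n).ε (i + 1) : ℝ) / n) atTop (𝓝 (E (i + 1))))
    (hB : ∀ i < 2, Tendsto (fun n => ((P n).b (i + 1) : ℝ) / n) atTop (𝓝 (B (i + 1))))
    (hV : ∀ i < 2, V (i + 1) = V i / 2 + E (i + 1) + B (i + 1)) :
    ∀ i ≤ 2, Tendsto (fun n => ((P n).v i : ℝ) / n) atTop (𝓝 (V i))
  | 0, _ => hV₀
  | i + 1, hi => by
    rw [hV i (by omega)]
    exact tendsto_nat_add (tendsto_nat_add (tendsto_nat_half (tendsto_v hP hV₀ hE hB hV i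
      (by omega))) (hE i (by omega))) (hB i (by omega))

/-- The exponent of the number of representations. -/
theorem hasExponent_r {P : ℕ → Params} (hP : ∀ n, (P n).Admissible) (hg : orderOf g = 6)
    (h7 : (7 : F) ≠ 0) {i : ℕ} (hi : i < 2) {Λ V E B : ℝ}
    (hN : Tendsto (fun n => ((P n).N : ℝ) / n) atTop (𝓝 Λ))
    (hv : Tendsto (fun n => ((P n).v i : ℝ) / n) atTop (𝓝 V))
    (hE : Tendsto (fun n => ((P n).ε (i + 1) : ℝ) / n) atTop (𝓝 E))
    (hB : Tendsto (fun n => ((P n).b (i + 1) : ℝ) / n) atTop (𝓝 B)) :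
    HasExponent (fun n => ((P n).r g i : ℝ))
      (eta (2 * B) + 2 * eta (V / 2 - B) - eta V + 2 * B +
        (eta E + eta (Λ - V - E) - eta (Λ - V) + Real.logb 2 6 * E)) := by
  have hb : ∀ n, (P n).b (i + 1) ≤ (P n).v i / 2 := fun n => by
    have := (hP n).overlap_le i hi
    omega
  have h2B := tendsto_nat_two_mul hB
  have hA := tendsto_nat_sub hb (tendsto_nat_half hv) hB
  have hsum := tendsto_nat_add h2B hA
  have e1 := hasExponent_choose (fun n => by have := hb n; omega) hv hsum
  have e2 := hasExponent_choose (fun n => by omega) hsum h2B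
  have e3 := HasExponent.const_pow (K := 2) two_pos h2B
  have e4 := hasExponent_choose_mul_pow (fun n => by have := (hP n).cancel_le i hi; omega)
    (tendsto_nat_sub (fun n => (hP n).v_le i hi.le) hN hv) hE
  have e := ((e1.mul e2).mul e3).mul e4
  have s1 : V - (2 * B + (V / 2 - B)) = V / 2 - B := by ring
  have s2 : 2 * B + (V / 2 - B) - 2 * B = V / 2 - B := by ring
  rw [s1, s2, Real.logb_self_eq_one one_lt_two] at e
  convert e using 1
  · ext n
    rw [(P n).r_eq (hP n) hg h7 hi, trinomial]
    push_cast
    ring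
  · ring

/-- A vector on level `i` has at least exponentially many representations in terms of its weight. -/
theorem two_pow_le_r {P : Params} (hP : P.Admissible) (hg : orderOf g = 6)
    (h7 : (7 : F) ≠ 0) {i : ℕ} (hi : i < 2) : 2 ^ (P.v i / 2 + P.b (i + 1)) ≤ P.r g i := by
  have h1 := hP.overlap_le i hi
  have h2 := hP.cancel_le i hi
  obtain ⟨m, hm⟩ := hP.even_weight i hi.le
  rw [P.r_eq hP hg h7 hi, trinomial]
  have h3 : 2 ^ (P.v i / 2 - P.b (i + 1)) ≤
      (P.v i).choose (2 * P.b (i + 1) + (P.v i / 2 - P.b (i + 1))) := by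
    rw [← Nat.choose_symm (by omega), show P.v i - (2 * P.b (i + 1) + (P.v i / 2 - P.b (i + 1))) =
      P.v i / 2 - P.b (i + 1) by omega]
    exact two_pow_le_choose (by omega)
  have h4 : 0 < (2 * P.b (i + 1) + (P.v i / 2 - P.b (i + 1))).choose (2 * P.b (i + 1)) :=
    Nat.choose_pos (by omega)
  have h5 : 0 < (P.N - P.v i).choose (P.ε (i + 1)) * 6 ^ P.ε (i + 1) :=
    Nat.mul_pos (Nat.choose_pos (by omega)) (by positivity)
  have h6 : 2 ^ (P.v i / 2 + P.b (i + 1)) =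
      2 ^ (P.v i / 2 - P.b (i + 1)) * 2 ^ (2 * P.b (i + 1)) := by
    rw [← pow_add]
    congr 1
    omega
  rw [h6]
  exact (Nat.mul_le_mul_right _ (h3.trans (Nat.le_mul_of_pos_right _ h4))).trans
    (Nat.le_mul_of_pos_right _ h5)

/-- The splitting of the parameters of a representation of a level-1 vector between the two halves
of the positions, as even as parities permit: `splitA` is the number of positions on the left half
which carry the first summand only. -/
def splitA (P : Params) : ℕ := (P.v 1 / 2 - P.b 2) / 2

/-- The number of positions on the right half which carry the first summand only. -/
def splitA' (P : Params) : ℕ := P.v 1 / 2 - P.b 2 - splitA P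

/-- The number of cancelling positions on the left half. It is rounded up while `splitA` is rounded
down: both totals have the same parity, so that the weight on each half is exactly `v₂ / 2`. -/
def splitC (P : Params) : ℕ := P.ε 2 - P.ε 2 / 2

/-- The chosen splitting yields two summands of weight `v₂ / 2` on either half, and there is room
for it. -/
theorem split_facts {P : Params} (hP : P.Admissible) :
    2 * splitA P + P.b 2 + (2 * splitA' P + P.b 2) = P.v 1 ∧
    splitA P + P.b 2 + splitC P = P.v 2 / 2 ∧
    splitA' P + P.b 2 + P.ε 2 / 2 = P.v 2 / 2 ∧
    2 * splitA P + P.b 2 + splitC P ≤ P.N / 2 ∧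
    2 * splitA' P + P.b 2 + P.ε 2 / 2 ≤ P.N / 2 := by
  have h1 := hP.overlap_le 1 (by omega)
  have h2 := hP.cancel_le 1 (by omega)
  obtain ⟨m₁, hm₁⟩ := hP.even_weight 1 (by omega)
  obtain ⟨m₂, hm₂⟩ := hP.even_weight 2 (by omega)
  obtain ⟨m, hm⟩ := hP.even_length
  have h3 : P.v 2 = P.v 1 / 2 + P.ε 2 + P.b 2 := rfl
  simp only [splitA', splitA, splitC, Nat.reduceAdd] at *
  omega

end Sequences

/-! ### The exponent of the enumeration cost -/

section CostExponent

variable {F : Type w} [Field F] [Fintype F] [DecidableEq F] {g : F}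

/-- The exponent of the enumeration cost, given the exponents of the sizes of the base lists, of
the number of level-1 vectors, of the matching probabilities, and of large families `G` of level-1
vectors with `M` decompositions each that the concatenation merges can find. -/
theorem hasExponent_enumerationCost {P : ℕ → Params} (hP : ∀ n, (P n).Admissible)
    (hg : orderOf g = 6) (h7 : (7 : F) ≠ 0) (s : ∀ n, Fin (P n).l → F) {S₁ S₂ U₀ U₁ T : ℝ}
    (hS₂ : 0 ≤ S₂) (hU₁ : 0 ≤ U₁) (hU : U₁ ≤ U₀) (hT : U₀ ≤ T)
    (hpos : 0 < S₁ → 0 < U₁)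
    (hβ : HasExponent (fun n => ((baseLeft g (P n).N ((P n).v 2 / 2)).card : ℝ)) (S₂ / 2))
    (hω : HasExponent (fun n => ((wellFormed g (P n).N ((P n).v 1)).card : ℝ)) S₁)
    (hτ : HasExponent (fun n => matchProb F (P n).l ((P n).u g 1)) (-U₁))
    (hτ' : HasExponent (fun n => matchProb F (P n).l (max ((P n).u g 0) ((P n).u g 1))) (-U₀))
    (hτl : HasExponent (fun n => matchProb F (P n).l (P n).l) (-T))
    {G : ∀ n, Finset (Fin (P n).N → F)} (hGW : ∀ n, G n ⊆ wellFormed g (P n).N ((P n).v 1))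
    {M : ℕ → ℕ} (hS : ∀ n, ∀ e ∈ G n, ∃ S : Finset (Fin (P n).N → F), S.card = M n ∧ ∀ x ∈ S,
      x ∈ balanced g (P n).N ((P n).v 2 / 2) ((P n).v 2 / 2) ∧
      e - x ∈ balanced g (P n).N ((P n).v 2 / 2) ((P n).v 2 / 2))
    (hG : HasExponent (fun n => ((G n).card : ℝ)) S₁)
    (hM : HasExponent (fun n => (M n : ℝ)) U₁) :
    HasExponent (fun n => enumerationCost g (P n) (s n))
      (max (max (S₂ / 2) (S₂ - U₁)) (max (2 * S₂ - U₁ - U₀) (2 * S₁ - U₀ - T))) := by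
  set C := max (max (S₂ / 2) (S₂ - U₁)) (max (2 * S₂ - U₁ - U₀) (2 * S₁ - U₀ - T)) with hC
  have c1 : S₂ / 2 ≤ C := (le_max_left _ _).trans (le_max_left _ _)
  have c2 : S₂ - U₁ ≤ C := (le_max_right _ _).trans (le_max_left _ _)
  have c3 : 2 * S₂ - U₁ - U₀ ≤ C := (le_max_left _ _).trans (le_max_right _ _)
  have c4 : 2 * S₁ - U₀ - T ≤ C := (le_max_right _ _).trans (le_max_right _ _)
  have hq : (0 : ℝ) < Fintype.card F := by exact_mod_cast Fintype.card_pos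
  have one := HasExponent.const one_pos
  have qe := HasExponent.const hq
  have hβ2 := hβ.pow 2
  rw [show ((2 : ℕ) : ℝ) * (S₂ / 2) = S₂ by push_cast; ring] at hβ2
  have hup := (((hβ.const_mul (K := 10) (by norm_num)).add
    ((one.add (hβ2.mul hτ)).const_mul (K := 8) (by norm_num))).add
    (((qe.add (hβ2.mul hτ')).mul (one.add (hβ2.mul hτ))).const_mul
      (K := 4 + Fintype.card F) (by positivity))).add ((hω.mul hτl).mul (one.add (hω.mul hτ')))
  have hle : ∀ᶠ n in atTop, enumerationCost g (P n) (s n) ≤ _ :=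
    Eventually.of_forall fun n => enumerationCost_le (P n) (hP n) hg h7 (s n)
  have hmax : max (max (max (S₂ / 2) (max 0 (S₂ + -U₁)))
      (max 0 (S₂ + -U₀) + max 0 (S₂ + -U₁))) (S₁ + -T + max 0 (S₁ + -U₀)) ≤ C := by
    refine max_le (max_le (max_le c1 (max_le (by linarith) (by linarith))) ?_) ?_
    · rcases max_choice 0 (S₂ + -U₀) with h | h <;> rcases max_choice 0 (S₂ + -U₁) with h' | h' <;>
        rw [h, h'] <;> linarith
    · rcases max_choice 0 (S₁ + -U₀) with h | h <;> rw [h]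
      -- `S₁ - T` is at most half of `2 * S₁ - U₀ - T`, since `U₀ ≤ T`.
      · linarith
      · linarith
  -- The lower bound comes from whichever term attains the maximum `C`.
  by_cases h1 : C ≤ S₂ / 2
  · exact hβ.squeeze_le hup h1 hmax
      (Eventually.of_forall fun n => card_baseLeft_le_enumerationCost (P n) (hP n) (s n)) hle
  rw [not_le] at h1
  by_cases h2 : C ≤ S₂ - U₁
  · exact ((hβ2.sub_const (by linarith) zero_le_one).mul hτ).squeeze_le hup (by linarith) hmax
      (Eventually.of_forall fun n => concatenation_le_enumerationCost (P n) (hP n) hg h7 (s n)) hle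
  by_cases h3 : C ≤ 2 * S₂ - U₁ - U₀
  · -- Here `S₂ > 0`, hence the pairs of dependent vectors are negligible.
    have hS₂' : 0 < S₂ := by linarith
    refine (((hβ2.sub_const hS₂' hq.le).mul hτ').mul
      ((hβ2.sub_const hS₂' zero_le_one).mul hτ)).squeeze_le hup (by linarith) hmax ?_ hle
    filter_upwards [hβ2.eventually_ge hS₂' (Fintype.card F)] with n hn
    exact representation_le_enumerationCost (P n) (hP n) hg h7 (s n) hn
  have h4 : C ≤ 2 * S₁ - U₀ - T := by
    rw [not_le] at h2 h3
    by_contra h4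
    rw [not_le] at h4
    exact lt_irrefl C (max_lt (max_lt h1 h2) (max_lt h3 h4))
  have hS₁' : 0 < S₁ := by linarith
  have hU₁' := hpos hS₁'
  have hq6 : (0 : ℝ) < (Fintype.card F : ℝ) ^ 6 := by positivity
  refine (((((hM.sub_const hU₁' hq6.le).mul hτ).pow 4).div
    (((HasExponent.const hq6).add (hM.mul hτ)).pow 4)).mul
    (((hG.sub_const hS₁' hq.le).mul hτl).mul ((hG.sub_const hS₁' zero_le_one).mul hτ'))).squeeze_le
      hup ?_ hmax ?_ hle
  · rw [add_neg_cancel, max_self]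
    push_cast
    linarith
  · filter_upwards [hM.eventually_ge hU₁' ((Fintype.card F : ℝ) ^ 6),
      hG.eventually_ge hS₁' (Fintype.card F)] with n hn hn'
    exact lastMerge_le_enumerationCost (P n) (hP n) (s n) (hGW n) hn hn' (hS n)

end CostExponent

end RSDP

open RSDP in
theorem mainTheorem2 {F : Type*} [Field F] [Fintype F] [DecidableEq F]
    (g : F) (hg : orderOf g = 6) (h7 : (7 : F) ≠ 0)
    (P : ℕ → Params) (hP : ∀ n, (P n).Admissible)
    (s : ∀ n, Fin (P n).l → F)
    (R L : ℝ) (V E B Sig U : ℕ → ℝ)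
    (hR : Tendsto (fun n => ((P n).k : ℝ) / n) atTop (𝓝 R))
    (hL : Tendsto (fun n => ((P n).l : ℝ) / n) atTop (𝓝 L))
    (hV₀ : Tendsto (fun n => ((P n).v₀ : ℝ) / n) atTop (𝓝 (V 0)))
    (hE : ∀ i < 2, Tendsto (fun n => ((P n).ε (i + 1) : ℝ) / n) atTop (𝓝 (E (i + 1))))
    (hB : ∀ i < 2, Tendsto (fun n => ((P n).b (i + 1) : ℝ) / n) atTop (𝓝 (B (i + 1))))
    (hV : ∀ i < 2, V (i + 1) = V i / 2 + E (i + 1) + B (i + 1))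
    (hSig : ∀ i ≤ 2, Sig i = (R + L) * h (V i / (R + L)) + Real.logb 2 6 * V i)
    (hU : ∀ i < 2, U i =
      V i * tri (2 * B (i + 1) / V i) ((V i / 2 - B (i + 1)) / V i) + 2 * B (i + 1)
        + (R + L - V i) * h (E (i + 1) / (R + L - V i)) + Real.logb 2 6 * E (i + 1))
    (hU₁ : U 1 ≤ U 0) (hU₀ : U 0 ≤ Real.logb 2 (Fintype.card F) * L) :
    -- the error set and its additive structure
    errorSet g = {1, -1, g, -g, g - 1, -(g - 1)} ∧
    (∀ e ∈ errorSet g, ∃ e₁ ∈ errorSet g, ∃ e₂ ∈ errorSet g, e₁ ≠ e₂ ∧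
      (errorSet g ×ˢ errorSet g).filter (fun p => p.1 + p.2 = e) = {(e₁, e₂), (e₂, e₁)}) ∧
    -- weights and sizes of the search spaces
    (∀ i ≤ 2, Tendsto (fun n => ((P n).v i : ℝ) / n) atTop (𝓝 (V i))) ∧
    (∀ i ≤ 2, HasExponent (fun n => ((wellFormed g (P n).N ((P n).v i)).card : ℝ)) (Sig i)) ∧
    -- numbers of representations
    (∀ i < 2, ∀ n, ∀ e ∈ wellFormed g (P n).N ((P n).v i),
      (representations g ((P n).v (i + 1)) ((P n).ε (i + 1)) ((P n).b (i + 1)) e).card =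
        trinomial ((P n).v i) (2 * (P n).b (i + 1)) ((P n).v i / 2 - (P n).b (i + 1))
          * 2 ^ (2 * (P n).b (i + 1))
          * (((P n).N - (P n).v i).choose ((P n).ε (i + 1)) * 6 ^ (P n).ε (i + 1))) ∧
    (∀ i < 2, HasExponent (fun n => ((P n).r g i : ℝ)) (U i)) ∧
    (∀ i < 2, Tendsto (fun n => Real.logb 2 (Fintype.card F) * (((P n).u g i : ℝ) / n))
      atTop (𝓝 (U i))) ∧
    -- the exponent of the enumeration cost
    HasExponent (fun n => enumerationCost g (P n) (s n))
      (max (max (Sig 2 / 2) (Sig 2 - U 1))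
        (max (2 * Sig 2 - U 1 - U 0)
          (2 * Sig 1 - U 0 - Real.logb 2 (Fintype.card F) * L))) := by
  have hA : Tendsto (fun n => ((P n).N : ℝ) / n) atTop (𝓝 (R + L)) := tendsto_nat_add hR hL
  have hv := tendsto_v hP hV₀ hE hB hV
  have hVn : ∀ i ≤ 2, 0 ≤ V i := fun i hi => tendsto_nat_nonneg (hv i hi)
  have hVA : ∀ i ≤ 2, V i ≤ R + L := fun i hi =>
    tendsto_nat_le (fun n => (hP n).v_le i hi) hA (hv i hi)
  have hEn : ∀ i < 2, 0 ≤ E (i + 1) := fun i hi => tendsto_nat_nonneg (hE i hi)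
  have hBn : ∀ i < 2, 0 ≤ B (i + 1) := fun i hi => tendsto_nat_nonneg (hB i hi)
  have hBV : ∀ i < 2, 2 * B (i + 1) ≤ V i := fun i hi =>
    tendsto_nat_le (fun n => (hP n).overlap_le i hi) (hv i hi.le) (tendsto_nat_two_mul (hB i hi))
  have hEV : ∀ i < 2, V i + E (i + 1) ≤ R + L := fun i hi =>
    tendsto_nat_le (fun n => (hP n).cancel_le i hi) hA (tendsto_nat_add (hv i hi.le) (hE i hi))
  have hSig' : ∀ i ≤ 2, Sig i =
      eta (V i) + eta (R + L - V i) - eta (R + L) + Real.logb 2 6 * V i := fun i hi => by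
    rw [hSig i hi, mul_h_div (hVn i hi) (hVA i hi)]
  have hU' : ∀ i < 2, U i = eta (2 * B (i + 1)) + 2 * eta (V i / 2 - B (i + 1)) - eta (V i) +
      2 * B (i + 1) + (eta (E (i + 1)) + eta (R + L - V i - E (i + 1)) - eta (R + L - V i) +
        Real.logb 2 6 * E (i + 1)) := fun i hi => by
    have h1 := hBV i hi
    have h2 := hBn i hi
    rw [hU i hi, mul_tri_div (by linarith) (by linarith) (by linarith),
      mul_h_div (hEn i hi) (by linarith [hEV i hi]),
      show V i - 2 * B (i + 1) - (V i / 2 - B (i + 1)) = V i / 2 - B (i + 1) by ring]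
    ring
  have hwf : ∀ i ≤ 2, HasExponent
      (fun n => ((wellFormed g (P n).N ((P n).v i)).card : ℝ)) (Sig i) := fun i hi => by
    rw [hSig' i hi]
    simp only [card_wellFormed hg h7]
    exact hasExponent_choose_mul_pow (fun n => (hP n).v_le i hi) hA (hv i hi)
  have hr : ∀ i < 2, HasExponent (fun n => ((P n).r g i : ℝ)) (U i) := fun i hi => by
    rw [hU' i hi]
    exact hasExponent_r hP hg h7 hi hA (hv i hi.le) (hE i hi) (hB i hi)
  have hu : ∀ i < 2, Tendsto (fun n => Real.logb 2 (Fintype.card F) * (((P n).u g i : ℝ) / n))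
      atTop (𝓝 (U i)) := fun i hi => tendsto_log_of_hasExponent Fintype.one_lt_card (hr i hi)
  refine ⟨errorSet_eq hg, exists_decompositions hg h7, hv, hwf,
    fun i hi n e he => (P n).card_representations (hP n) hg h7 hi he, hr, hu, ?_⟩
  -- Every level-1 vector has at least `2 ^ (v₁ / 2 + b₂)` representations.
  have hUV : V 1 / 2 + B 2 ≤ U 1 := by
    have h1 := HasExponent.const_pow (K := 2) two_pos
      (tendsto_nat_add (tendsto_nat_half (hv 1 one_le_two)) (hB 1 one_lt_two))
    rw [Real.logb_self_eq_one one_lt_two, one_mul] at h1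
    refine h1.le (hr 1 one_lt_two) (Eventually.of_forall fun n => ?_)
    exact_mod_cast two_pow_le_r (hP n) hg h7 one_lt_two
  have hB2 := hBn 1 one_lt_two
  have hV1 := hVn 1 one_le_two
  have hq : 0 ≤ Real.logb 2 (Fintype.card F) :=
    Real.logb_nonneg one_lt_two (by exact_mod_cast Fintype.card_pos)
  have hlQ := hL.const_mul (Real.logb 2 (Fintype.card F))
  have hτ := hasExponent_matchProb (hu 1 one_lt_two) hlQ
  rw [min_eq_left (hU₁.trans hU₀)] at hτ
  have hτ' : HasExponent (fun n => matchProb F (P n).l (max ((P n).u g 0) ((P n).u g 1)))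
      (-U 0) := by
    have hmax := (hu 0 two_pos).max (hu 1 one_lt_two)
    rw [max_eq_left hU₁] at hmax
    have h1 := hasExponent_matchProb (F := F) (p := fun n => max ((P n).u g 0) ((P n).u g 1))
      (hmax.congr fun n => by
        rw [← mul_max_of_nonneg _ _ hq, max_div_div_right n.cast_nonneg, ← Nat.cast_max]) hlQ
    rwa [min_eq_left hU₀] at h1
  have hτl := hasExponent_matchProb hlQ hlQ
  rw [min_self] at hτl
  have hhalf : ∀ n, (P n).v 2 / 2 ≤ (P n).N / 2 := fun n =>
    Nat.div_le_div_right ((hP n).v_le 2 le_rfl)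
  have hβ : HasExponent (fun n => ((baseLeft g (P n).N ((P n).v 2 / 2)).card : ℝ)) (Sig 2 / 2) := by
    simp only [card_baseLeft hg h7]
    have h1 := hasExponent_choose_mul_pow hhalf (tendsto_nat_half hA)
      (tendsto_nat_half (hv 2 le_rfl))
    convert h1 using 1
    have e1 := two_mul_eta_half (V 2)
    have e2 := two_mul_eta_half (R + L)
    have e3 := two_mul_eta_half (R + L - V 2)
    rw [hSig' 2 le_rfl, ← sub_div]
    linarith
  have hf := fun n => split_facts (hP n)
  have hα : Tendsto (fun n => (((P n).v 1 / 2 - (P n).b 2 : ℕ) : ℝ) / n) atTop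
      (𝓝 (V 1 / 2 - B 2)) :=
    tendsto_nat_sub (fun n => by
      have : 2 * (P n).b 2 ≤ (P n).v 1 := (hP n).overlap_le 1 one_lt_two
      omega)
      (tendsto_nat_half (hv 1 one_le_two)) (hB 1 one_lt_two)
  have ha : Tendsto (fun n => (splitA (P n) : ℝ) / n) atTop (𝓝 ((V 1 / 2 - B 2) / 2)) :=
    tendsto_nat_half hα
  have ha' : Tendsto (fun n => (splitA' (P n) : ℝ) / n) atTop (𝓝 ((V 1 / 2 - B 2) / 2)) := by
    have h1 := tendsto_nat_sub (fun n => Nat.div_le_self _ 2) hα ha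
    rwa [sub_half] at h1
  have hc' := tendsto_nat_half (hE 1 one_lt_two)
  have hc : Tendsto (fun n => (splitC (P n) : ℝ) / n) atTop (𝓝 (E 2 / 2)) := by
    have h1 := tendsto_nat_sub (fun n => Nat.div_le_self _ 2) (hE 1 one_lt_two) hc'
    rwa [sub_half] at h1
  have hb : Tendsto (fun n => ((P n).b 2 : ℝ) / n) atTop (𝓝 (B 2)) := hB 1 one_lt_two
  have hM := (hasExponent_splitCount (fun n => by have := hf n; omega)
    (fun n => (hf n).2.2.2.1) (tendsto_nat_half hA) ha hb hc).mul
    (hasExponent_splitCount (fun n => by have := hf n; omega)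
    (fun n => (hf n).2.2.2.2) (tendsto_nat_half hA) ha' hb hc')
  have hG := (hasExponent_choose_mul_pow (fun n => by have := hf n; omega) (tendsto_nat_half hA)
      (tendsto_nat_add (tendsto_nat_two_mul ha) hb)).mul
    (hasExponent_choose_mul_pow (fun n => by have := hf n; omega) (tendsto_nat_half hA)
      (tendsto_nat_add (tendsto_nat_two_mul ha') hb))
  have hS : ∀ n, ∀ e ∈ balanced g (P n).N (2 * splitA (P n) + (P n).b 2)
      (2 * splitA' (P n) + (P n).b 2), ∃ S : Finset (Fin (P n).N → F),
      S.card = splitCount ((P n).N / 2) (splitA (P n)) ((P n).b 2) (splitC (P n)) *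
        splitCount ((P n).N / 2) (splitA' (P n)) ((P n).b 2) ((P n).ε 2 / 2) ∧
      ∀ x ∈ S, x ∈ balanced g (P n).N ((P n).v 2 / 2) ((P n).v 2 / 2) ∧
        e - x ∈ balanced g (P n).N ((P n).v 2 / 2) ((P n).v 2 / 2) := fun n e he =>
    exists_balanced_splittings hg h7 (hP n).even_length (hf n).2.1 (hf n).2.2.1 he
  have s1 : 2 * ((V 1 / 2 - B 2) / 2) + B 2 = V 1 / 2 := by ring
  have e1 := two_mul_eta_half (V 1)
  have e2 := two_mul_eta_half (V 1 / 2 - B 2)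
  have e3 := two_mul_eta_half (R + L)
  have e4 := two_mul_eta_half (R + L - V 1)
  have e5 := two_mul_eta_half (R + L - V 1 - E 2)
  have e6 := two_mul_eta_half (E 2)
  have e7 := two_mul_eta_half (2 * B 2)
  rw [mul_div_cancel_left₀ _ (two_ne_zero' ℝ)] at e7
  have e4' : (R + L) / 2 - V 1 / 2 = (R + L - V 1) / 2 := by ring
  have e5' : (R + L - V 1) / 2 - E 2 / 2 = (R + L - V 1 - E 2) / 2 := by ring
  refine hasExponent_enumerationCost hP hg h7 s ?_ ?_ hU₁ hU₀ ?_ hβ (hwf 1 one_le_two) hτ hτ' hτl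
    (fun n => balanced_subset (hf n).1) hS ?_ ?_
  · refine (hwf 2 le_rfl).nonneg (Eventually.of_forall fun n => ?_)
    rw [card_wellFormed hg h7]
    exact_mod_cast Nat.mul_pos (Nat.choose_pos ((hP n).v_le 2 le_rfl)) (by positivity)
  · linarith
  · intro h1
    by_contra h2
    have h3 : V 1 = 0 := by linarith
    rw [hSig' 1 one_le_two, h3, eta_zero] at h1
    simp at h1
  · convert hG using 1
    · ext n
      rw [card_balanced hg h7 (hP n).even_length]
      push_cast
      ring
    · simp only [Nat.reduceAdd, s1, e4'] at *
      rw [hSig' 1 one_le_two]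
      linarith
  · convert hM using 1
    · ext n
      push_cast
      ring
    · simp only [Nat.reduceAdd, s1, e4', e5'] at *
      rw [hU' 1 one_lt_two]
      linarith
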